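/- Let $R$ be a commutative noetherian ring, let $G$ and $F$ be free $R$-modules of finite ranks $n$ and $m$, put $r=n-m$ and assume $r>1$. Let $\psi\colon G\to F$ be an $R$-linear map, let $\psi^*\colon F^*\to G^*$ be its dual (where $(-)^*=\operatorname{Hom}_R(-,R)$), and put $M=\operatorname{Cok}\psi^*$. For an ideal $I$, let $\operatorname{grade} I$ be the supremum of the lengths of the $R$-regular sequences contained in $I$ if $I\neq R$, and $\operatorname{grade} R=\infty$. Assume that the ideal $\operatorname{I}_M$ generated by the $m$-minors of a matrix representing $\psi$ has grade exactly $r+1$. Then there exists a linear form $\chi\colon M\to R$ with $\operatorname{grade}\operatorname{Im}\chi=r+1$ if and only if there exists a submodule $U$ of $M$ with the following properties: (1) $\operatorname{rank} U=r-1$; (2) $U$ is reflexive and orientable, and $U_{\mathfrak p}$ is a free direct summand of $M_{\mathfrak p}$ for every prime ideal $\mathfrak p$ of $R$ with $\operatorname{grade}\mathfrak p\le r$. Here an $R$-module $N$ has rank $k$ if $N\otimes_R Q$ is a free $Q$-module of rank $k$, where $Q$ is the total ring of fractions of $R$; $N$ is reflexive if the natural map $N\to N^{**}$ is an isomorphism;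 and a module $N$ of rank $k$ is orientable if $(\bigwedge^k N)^{**}\cong R$. -/

import Mathlib

namespace KoszulProjDimOne

open Module

/-- The grade of an ideal `I` of a (Noetherian) commutative ring `R`: the supremum of the lengths
of `R`-regular sequences contained in `I`. For a proper ideal a weakly regular sequence in `I` is
automatically regular; for `I = R` the value is `⊤`, the usual convention. -/
noncomputable def idealGrade {R : Type*} [CommRing R] (I : Ideal R) : ℕ∞ :=
  ⨆ rs : {rs : List R // RingTheory.Sequence.IsWeaklyRegular R rs ∧ ∀ x ∈ rs, x ∈ I},
    (rs.1.length : ℕ∞)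

/-- The ideal of maximal (`m × m`) minors of the matrix of `ψ : G → F` with respect to bases of
`G` and `F`, where `F` has rank `m`. The columns are selected by an arbitrary map `s`: a repeated
column contributes `0` and a permutation only changes the sign. -/
noncomputable def maximalMinors {R G F : Type*} [CommRing R] [AddCommGroup G] [Module R G]
    [AddCommGroup F] [Module R F] {m n : ℕ} (bG : Basis (Fin n) R G) (bF : Basis (Fin m) R F)
    (ψ : G →ₗ[R] F) : Ideal R :=
  Ideal.span (Set.range fun s : Fin m → Fin n =>
    ((LinearMap.toMatrix bG bF ψ).submatrix id s).det)

/-- The cokernel of the dual map `ψ* : F* → G*`. -/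
abbrev CokerDual {R G F : Type*} [CommRing R] [AddCommGroup G] [Module R G]
    [AddCommGroup F] [Module R F] (ψ : G →ₗ[R] F) : Type _ :=
  Dual R G ⧸ LinearMap.range ψ.dualMap

/-- `N` has rank `k`: it becomes free of rank `k` over the total ring of fractions of `R`. -/
def HasRank (R N : Type*) [CommRing R] [AddCommGroup N] [Module R N] (k : ℕ) : Prop :=
  Nonempty (Basis (Fin k) (Localization (nonZeroDivisors R))
    (LocalizedModule (nonZeroDivisors R) N))

/-- `N` is orientable: it has a rank `k`, and the double dual of its `k`-th exterior power is
isomorphic to `R`. -/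
def IsOrientable (R N : Type*) [CommRing R] [AddCommGroup N] [Module R N] : Prop :=
  ∃ k : ℕ, HasRank R N k ∧ Nonempty (Dual R (Dual R (⋀[R]^k N)) ≃ₗ[R] R)

/-- The localization `U_p`, as a submodule of `N_p`, is free and a direct summand of `N_p`. -/
def IsFreeDirectSummandAt {R N : Type*} [CommRing R] [AddCommGroup N] [Module R N]
    (U : Submodule R N) (p : Ideal R) [p.IsPrime] : Prop :=
  Module.Free (Localization p.primeCompl) (U.localized p.primeCompl) ∧
    ∃ W : Submodule (Localization p.primeCompl) (LocalizedModule p.primeCompl N),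
      IsCompl (U.localized p.primeCompl) W

end KoszulProjDimOne

/-! ### Grade, weakly regular sequences and height -/

namespace KoszulProjDimOne

open RingTheory.Sequence CategoryTheory Abelian Pointwise

/-! Let `A` be the matrix of `ψ`. The determinant of the rows of `A` followed by lifts of `r`
vectors of `M` is an alternating `r`-form `ω` on `M`. Its values generate an ideal containing the
maximal minors, and it inherits Cramer's rule `ω(v) y = ∑ ω(v with vᵢ replaced by y) vᵢ`
(`IsCramer`, `exists_cramer_form`). Hence `M` is free of rank `r` wherever a value of `ω` is
inverted. The rest is linear algebra with `ω`, combined with the fact that grade is detected on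
primes (`natCast_le_idealGrade_of_forall_prime`).

Given `χ`, take `U = Ker χ`. Dividing by `χ` gives `ω(x, u) = χ(x) α(u)` with a Cramer form `α` of
degree `r - 1` on `U`, and `α` has a value outside every prime containing neither `Im χ` nor all
values of `ω`. Primes of grade at most `r` are of this kind, so `U` is free there. The values of `α`
generate an ideal of grade at least `2`, so `α` freely generates the `(r-1)`-forms and `U` is
orientable. Reflexivity descends from `M`, which is reflexive because a regular sequence of length
three, with minors as entries, leaves a regular pair on `M`.

Given `U`, orientability makes the module of `(r-1)`-forms on `U` free of rank one, so the
contractions `ω(x, ·)` restricted to `U` are `χ(x) α` for a functional `χ`. At a prime of grade at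
most `r`, a basis of the summand completed by a generator of its complement gives `ω` a unit value,
so `Im χ` is not in that prime and has grade at least `r + 1`.

The grade of `Im χ` never exceeds `r + 1` (`idealGrade_range_le`): a functional is a relation
between the columns of `A`, and at a prime missing one coefficient a column can be dropped. The
Eagon–Northcott bound then makes the height of a minimal prime of the minors at most `r`, below
their grade. -/

theorem IsWeaklyRegular.take {R M : Type*} [CommRing R] [AddCommGroup M] [Module R M]
    {rs : List R} (h : IsWeaklyRegular M rs) (k : ℕ) : IsWeaklyRegular M (rs.take k) := by
  rw [← List.take_append_drop k rs, isWeaklyRegular_append_iff] at h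
  exact h.1

theorem natCast_le_idealGrade_iff {R : Type*} [CommRing R] (I : Ideal R) (k : ℕ) :
    (k : ℕ∞) ≤ idealGrade I ↔
      ∃ rs : List R, IsWeaklyRegular R rs ∧ (∀ x ∈ rs, x ∈ I) ∧ rs.length = k := by
  constructor
  · intro h
    rcases Nat.eq_zero_or_pos k with rfl | hk
    · exact ⟨[], IsWeaklyRegular.nil R R, by simp, rfl⟩
    · obtain ⟨j, rfl⟩ : ∃ j, k = j + 1 := ⟨k - 1, by omega⟩
      have h' : (j : ℕ∞) < idealGrade I := lt_of_lt_of_le (by exact_mod_cast Nat.lt_succ_self j) h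
      obtain ⟨⟨rs, hrs, hI⟩, hlt⟩ := lt_iSup_iff.1 h'
      have hlt' : j < rs.length := by exact_mod_cast hlt
      refine ⟨rs.take (j + 1), IsWeaklyRegular.take hrs _,
        fun x hx => hI x (List.mem_of_mem_take hx), ?_⟩
      rw [List.length_take]; omega
  · rintro ⟨rs, hrs, hI, rfl⟩
    exact le_iSup (fun rs : {rs : List R // IsWeaklyRegular R rs ∧ ∀ x ∈ rs, x ∈ I} =>
      (rs.1.length : ℕ∞)) ⟨rs, hrs, hI⟩

theorem idealGrade_mono {R : Type*} [CommRing R] {I J : Ideal R} (h : I ≤ J) :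
    idealGrade I ≤ idealGrade J :=
  iSup_le fun rs => le_iSup (fun rs : {rs : List R // IsWeaklyRegular R rs ∧ ∀ x ∈ rs, x ∈ J} =>
      (rs.1.length : ℕ∞)) ⟨rs.1, rs.2.1, fun x hx => h (rs.2.2 x hx)⟩

universe u

/-- Passing to the quotient by a weakly regular sequence shifts the vanishing of `Ext` down to the
vanishing of `Hom`. -/
theorem subsingleton_hom_quotient_of_ext {R : Type u} [CommRing R] (N : ModuleCat.{u} R)
    (rs : List R) : ∀ (M : ModuleCat.{u} R), IsWeaklyRegular M rs →
      (∀ i ≤ rs.length, Subsingleton (Ext N M i)) →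
      Subsingleton (N →ₗ[R] (M ⧸ (Ideal.ofList rs • ⊤ : Submodule R M))) := by
  induction rs with
  | nil =>
    intro M _ h
    have : Subsingleton (N ⟶ M) := Ext.addEquiv₀.subsingleton_congr.mp (h 0 le_rfl)
    have : Subsingleton (N →ₗ[R] M) := ModuleCat.homAddEquiv.symm.subsingleton
    have e : (M ⧸ (Ideal.ofList ([] : List R) • ⊤ : Submodule R M)) ≃ₗ[R] M :=
      Submodule.quotEquivOfEqBot _ (by rw [Ideal.ofList_nil, Submodule.bot_smul])
    refine ⟨fun f g => ?_⟩
    have := Subsingleton.elim (e.toLinearMap ∘ₗ f) (e.toLinearMap ∘ₗ g)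
    ext x
    exact e.injective (LinearMap.congr_fun this x)
  | cons a rs ih =>
    intro M hreg h
    rw [isWeaklyRegular_cons_iff] at hreg
    have key := ih (ModuleCat.of R (QuotSMulTop a M)) hreg.2 (by
      intro i hi
      have zero1 := AddCommGrpCat.isZero_of_iff_subsingleton.mpr
        (h i (by simp only [List.length_cons]; omega))
      have zero2 := AddCommGrpCat.isZero_of_iff_subsingleton.mpr
        (h (i + 1) (by simp only [List.length_cons]; omega))
      exact AddCommGrpCat.subsingleton_of_isZero <| ShortComplex.Exact.isZero_of_both_zeros
        ((Ext.covariant_sequence_exact₃' N hreg.1.smulShortComplex_shortExact) i (i + 1) rfl)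
        (zero1.eq_zero_of_src _) (zero2.eq_zero_of_tgt _))
    let e := Submodule.quotOfListConsSMulTopEquivQuotSMulTopInner M a rs
    refine ⟨fun f g => ?_⟩
    have := Subsingleton.elim (e.toLinearMap ∘ₗ f) (e.toLinearMap ∘ₗ g)
    ext x
    exact e.injective (LinearMap.congr_fun this x)

/-- A weakly regular sequence in `I` that is shorter than the grade of every prime containing `I`
can be extended by an element of `I`. -/
theorem exists_isSMulRegular_quotient {R : Type u} [CommRing R] [IsNoetherianRing R] {I : Ideal R}
    {k : ℕ} (h : ∀ (p : Ideal R) [p.IsPrime], I ≤ p → (k : ℕ∞) ≤ idealGrade p)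
    {rs : List R} (hrs : IsWeaklyRegular R rs) (hk : rs.length < k) :
    ∃ a ∈ I, IsSMulRegular (R ⧸ (Ideal.ofList rs • ⊤ : Submodule R R)) a := by
  by_contra! hcon
  set Q := R ⧸ (Ideal.ofList rs • ⊤ : Submodule R R)
  have hsub : (I : Set R) ⊆ ⋃ p ∈ associatedPrimes R Q, (p : Set R) := by
    intro a ha
    rw [biUnion_associatedPrimes_eq_zero_divisors]
    have := hcon a ha
    rw [isSMulRegular_iff_right_eq_zero_of_smul] at this
    push Not at this
    obtain ⟨z, hz, hz0⟩ := this
    exact ⟨z, hz0, hz⟩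
  have hfin := associatedPrimes.finite R Q
  obtain ⟨p, hp, hIp⟩ := (Ideal.subset_union_prime_finite hfin (f := id) ⊥ ⊥
    (fun p hp _ _ => hp.isPrime)).1 hsub
  have hIp : I ≤ p := hIp
  have hpp : p.IsPrime := hp.isPrime
  -- Rees' argument: a regular sequence of length `k` in `p` kills `Ext^i(R/p, R)` for `i < k`,
  -- hence `Hom(R/p, Q)`, although `p` is associated to `Q`.
  obtain ⟨ys, hys, hysp, hlen⟩ := (natCast_le_idealGrade_iff p k).1 (h p hIp)
  have hlt : p • (⊤ : Submodule R (ModuleCat.of R R)) < ⊤ := by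
    rw [lt_top_iff_ne_top]
    intro heq
    apply hpp.ne_top
    simpa using heq
  have hreg : IsRegular R ys := by
    refine ⟨hys, fun heq => hpp.ne_top ?_⟩
    rw [smul_eq_mul, Ideal.mul_top] at heq
    rw [eq_top_iff, heq]
    exact Ideal.span_le.2 hysp
  have hext := ModuleCat.subsingleton_ext_of_exists_isRegular p (ModuleCat.of R (R ⧸ p))
    (by rw [show Module.support R (ModuleCat.of R (R ⧸ p)) = Module.support R (R ⧸ p) from rfl,
      Module.support_eq_zeroLocus, Ideal.annihilator_quotient])
    (ModuleCat.of R R) hlt ys hysp hreg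
  have hs := subsingleton_hom_quotient_of_ext (ModuleCat.of R (R ⧸ p)) rs (ModuleCat.of R R) hrs
    (fun i hi => hext i (by omega))
  obtain ⟨f, hf⟩ := (isAssociatedPrime_iff_exists_injective_linearMap (M := Q) p).1 hp |>.2
  have h0 : f = 0 := @Subsingleton.elim _ hs f 0
  apply hpp.ne_top
  rw [Ideal.eq_top_iff_one, ← Ideal.Quotient.eq_zero_iff_mem]
  apply hf
  rw [h0]; rfl

/-- Sequences in `I` are extended one element at a time. This reduces every lower bound on grade
below to a question about single primes. -/
theorem natCast_le_idealGrade_of_forall_prime {R : Type u} [CommRing R] [IsNoetherianRing R]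
    {I : Ideal R} {k : ℕ} (h : ∀ (p : Ideal R) [p.IsPrime], I ≤ p → (k : ℕ∞) ≤ idealGrade p) :
    (k : ℕ∞) ≤ idealGrade I := by
  rw [natCast_le_idealGrade_iff]
  suffices H : ∀ j ≤ k, ∃ rs : List R, IsWeaklyRegular R rs ∧ (∀ x ∈ rs, x ∈ I) ∧ rs.length = j from
    H k le_rfl
  intro j
  induction j with
  | zero => exact fun _ => ⟨[], IsWeaklyRegular.nil R R, by simp, rfl⟩
  | succ j ih =>
    intro hj
    obtain ⟨rs, hrs, hI, hlen⟩ := ih (by omega)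
    obtain ⟨a, ha, hreg⟩ := exists_isSMulRegular_quotient h hrs (by omega)
    refine ⟨rs ++ [a], ?_, ?_, by simp [hlen]⟩
    · rw [isWeaklyRegular_append_iff, isWeaklyRegular_singleton_iff]
      exact ⟨hrs, hreg⟩
    · intro x hx
      rcases List.mem_append.1 hx with hx | hx
      · exact hI x hx
      · rw [List.mem_singleton.1 hx]; exact ha

theorem isSMulRegular_quotient_ofList_iff {R : Type*} [CommRing R] (rs : List R) (a : R) :
    IsSMulRegular (R ⧸ (Ideal.ofList rs • ⊤ : Submodule R R)) a ↔
      ∀ x : R, a * x ∈ Ideal.ofList rs → x ∈ Ideal.ofList rs := by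
  rw [isSMulRegular_iff_right_eq_zero_of_smul]
  have e : (Ideal.ofList rs • ⊤ : Submodule R R) = Ideal.ofList rs := by
    rw [smul_eq_mul, Ideal.mul_top]
  constructor
  · intro h x hx
    have := h (Submodule.Quotient.mk x) (by
      rw [← Submodule.Quotient.mk_smul, Submodule.Quotient.mk_eq_zero, e]; exact hx)
    rwa [Submodule.Quotient.mk_eq_zero, e] at this
  · intro h x
    induction x using Submodule.Quotient.induction_on with | _ x
    rw [← Submodule.Quotient.mk_smul, Submodule.Quotient.mk_eq_zero,
      Submodule.Quotient.mk_eq_zero, e]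
    exact h x

/-- The last element is a nonzerodivisor modulo the earlier ones, so it lies in no minimal prime
over them; each element therefore forces a strictly larger prime. -/
theorem length_le_height_of_isWeaklyRegular {R : Type*} [CommRing R] [IsNoetherianRing R]
    (rs : List R) : IsWeaklyRegular R rs →
      ∀ (q : Ideal R) [q.IsPrime], (∀ x ∈ rs, x ∈ q) → (rs.length : ℕ∞) ≤ q.height := by
  induction rs using List.reverseRecOn with
  | nil => simp
  | append_singleton rs a ih =>
    intro h q _ hq
    rw [isWeaklyRegular_append_iff, isWeaklyRegular_singleton_iff,
      isSMulRegular_quotient_ofList_iff] at h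
    have hle : Ideal.ofList rs ≤ q := Ideal.span_le.2 fun x hx => hq x (by simp_all)
    obtain ⟨q', hq', hle'⟩ := Ideal.exists_minimalPrimes_le hle
    have := hq'.1.1
    have hlt : q' < q := by
      refine lt_of_le_of_ne hle' ?_
      rintro rfl
      have ha : a ∈ q' := hq a (by simp)
      obtain ⟨x, hx, hxn⟩ := Ideal.exists_mul_mem_of_mem_minimalPrimes hq' ha
      exact hx (h.2 x hxn)
    have h1 := ih h.1 q' (fun x hx => hq'.1.2 (Ideal.subset_span hx))
    calc ((rs ++ [a]).length : ℕ∞) = rs.length + 1 := by simp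
      _ ≤ q'.height + 1 := by gcongr
      _ ≤ q.height := Ideal.height_add_one_le_of_lt_of_isPrime hlt

theorem natCast_le_height {R : Type*} [CommRing R] [IsNoetherianRing R] {I q : Ideal R} {k : ℕ}
    (hI : (k : ℕ∞) ≤ idealGrade I) [q.IsPrime] (hq : I ≤ q) : (k : ℕ∞) ≤ q.height := by
  obtain ⟨rs, hrs, h, rfl⟩ := (natCast_le_idealGrade_iff I k).1 hI
  exact length_le_height_of_isWeaklyRegular rs hrs q fun x hx => hq (h x hx)

theorem exists_regular_pair_of_two_le_idealGrade {R : Type*} [CommRing R] {I : Ideal R}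
    (h : 2 ≤ idealGrade I) : ∃ a ∈ I, ∃ b ∈ I, (∀ x, a * x = 0 → x = 0) ∧
      ∀ x, b * x ∈ Ideal.span {a} → x ∈ Ideal.span {a} := by
  obtain ⟨rs, hrs, hI, hlen⟩ := (natCast_le_idealGrade_iff I 2).1 (by exact_mod_cast h)
  obtain ⟨a, b, rfl⟩ := List.length_eq_two.1 hlen
  rw [show [a, b] = [a] ++ [b] from rfl, isWeaklyRegular_append_iff, isWeaklyRegular_singleton_iff,
    isWeaklyRegular_singleton_iff, isSMulRegular_quotient_ofList_iff, Ideal.ofList_singleton,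
    isSMulRegular_iff_right_eq_zero_of_smul] at hrs
  exact ⟨a, hI a (by simp), b, hI b (by simp), fun x hx => hrs.1 x hx, hrs.2⟩

theorem exists_regular_triple_of_three_le_idealGrade {R : Type*} [CommRing R] {I : Ideal R}
    (h : 3 ≤ idealGrade I) : ∃ a ∈ I, ∃ b ∈ I, ∃ c ∈ I, (∀ x, a * x = 0 → x = 0) ∧
      (∀ x, b * x ∈ Ideal.span {a} → x ∈ Ideal.span {a}) ∧
      ∀ x, c * x ∈ Ideal.span {a, b} → x ∈ Ideal.span {a, b} := by
  obtain ⟨rs, hrs, hI, hlen⟩ := (natCast_le_idealGrade_iff I 3).1 (by exact_mod_cast h)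
  obtain ⟨a, b, c, rfl⟩ := List.length_eq_three.1 hlen
  rw [show [a, b, c] = ([a] ++ [b]) ++ [c] from rfl, isWeaklyRegular_append_iff,
    isWeaklyRegular_append_iff, isWeaklyRegular_singleton_iff,
    isWeaklyRegular_singleton_iff, isWeaklyRegular_singleton_iff,
    isSMulRegular_quotient_ofList_iff, isSMulRegular_quotient_ofList_iff, Ideal.ofList_append,
    Ideal.ofList_singleton, Ideal.ofList_singleton, ← Ideal.span_union,
    isSMulRegular_iff_right_eq_zero_of_smul] at hrs
  exact ⟨a, hI a (by simp), b, hI b (by simp), c, hI c (by simp), fun x hx => hrs.1.1 x hx,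
    hrs.1.2, hrs.2⟩

end KoszulProjDimOne

/-! ### Heights of determinantal ideals -/

namespace KoszulProjDimOne

open Matrix Polynomial

/-- The ideal generated by the minors of maximal size of a matrix with `m` rows. -/
def minorsIdeal {R : Type*} [CommRing R] {m n : ℕ} (A : Matrix (Fin m) (Fin n) R) : Ideal R :=
  Ideal.span (Set.range fun s : Fin m → Fin n => (A.submatrix id s).det)

theorem forall_det_submatrix_eq_zero_iff {K : Type*} [Field K] {m n : ℕ}
    (A : Matrix (Fin m) (Fin n) K) :
    (∀ s : Fin m → Fin n, (A.submatrix id s).det = 0) ↔ ∃ v, v ≠ 0 ∧ v ᵥ* A = 0 := by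
  constructor
  · intro h
    by_contra! hcon
    have hrows : LinearIndependent K A.row := by
      rw [← vecMul_injective_iff]
      intro v w hvw
      by_contra hne
      exact hcon (v - w) (sub_ne_zero.2 hne) (by rw [sub_vecMul]; exact sub_eq_zero.2 hvw)
    have hrank := hrows.rank_matrix
    rw [rank_eq_finrank_span_cols, Fintype.card_fin] at hrank
    obtain ⟨κ, a, ha, hspan, hli⟩ := exists_linearIndependent' K A.col
    have : Finite κ := Finite.of_injective a ha
    have : Fintype κ := Fintype.ofFinite κ
    rw [← hspan, finrank_span_eq_card hli] at hrank
    let e : Fin m ≃ κ := (Fintype.equivFinOfCardEq hrank).symm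
    have hli' : LinearIndependent K (A.submatrix id (a ∘ e)).col := hli.comp e e.injective
    rw [linearIndependent_cols_iff_isUnit, isUnit_iff_isUnit_det] at hli'
    exact hli'.ne_zero (h _)
  · rintro ⟨v, hv, hvA⟩ s
    rw [← exists_vecMul_eq_zero_iff]
    refine ⟨v, hv, ?_⟩
    ext j
    exact congrFun hvA (s j)

theorem minorsIdeal_le_ker_iff {R K : Type*} [CommRing R] [Field K] {m n : ℕ}
    (A : Matrix (Fin m) (Fin n) R) (φ : R →+* K) :
    minorsIdeal A ≤ RingHom.ker φ ↔ ∃ v, v ≠ 0 ∧ v ᵥ* A.map φ = 0 := by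
  rw [← forall_det_submatrix_eq_zero_iff, minorsIdeal, Ideal.span_le, Set.range_subset_iff]
  refine forall_congr' fun s => ?_
  rw [SetLike.mem_coe, RingHom.mem_ker, RingHom.map_det]
  rfl

/-- Containment of the minors in a prime becomes linear dependence of the rows over the residue
field. Changes of the matrix can then be checked by linear algebra over fields, without identities
between minors. -/
theorem minorsIdeal_le_prime_iff {R : Type*} [CommRing R] {m n : ℕ}
    (A : Matrix (Fin m) (Fin n) R) (q : Ideal R) [q.IsPrime] :
    minorsIdeal A ≤ q ↔ ∃ v, v ≠ 0 ∧ v ᵥ* A.map (algebraMap R q.ResidueField) = 0 := by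
  rw [← minorsIdeal_le_ker_iff, Ideal.ker_algebraMap_residueField]

/-- The Schur complement of the entry `(i₀, j₀)`, with denominators cleared. -/
def schurComplement {R : Type*} [CommRing R] {m n : ℕ} (A : Matrix (Fin (m + 1)) (Fin (n + 1)) R)
    (i₀ : Fin (m + 1)) (j₀ : Fin (n + 1)) : Matrix (Fin m) (Fin n) R :=
  Matrix.of fun i j => A i₀ j₀ * A (i₀.succAbove i) (j₀.succAbove j) -
    A (i₀.succAbove i) j₀ * A i₀ (j₀.succAbove j)

/-- Gaussian elimination with pivot `(i₀, j₀)`: column `j₀` determines the coefficient of row `i₀`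
from the others. -/
theorem exists_vecMul_schurComplement_iff {K : Type*} [Field K] {m n : ℕ}
    (A : Matrix (Fin (m + 1)) (Fin (n + 1)) K) (i₀ : Fin (m + 1)) (j₀ : Fin (n + 1))
    (h : A i₀ j₀ ≠ 0) :
    (∃ v, v ≠ 0 ∧ v ᵥ* A = 0) ↔ ∃ v, v ≠ 0 ∧ v ᵥ* schurComplement A i₀ j₀ = 0 := by
  have key : ∀ v : Fin (m + 1) → K, ∀ j, (v ᵥ* A) j =
      v i₀ * A i₀ j + ∑ i, v (i₀.succAbove i) * A (i₀.succAbove i) j := fun v j => by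
    rw [vecMul, dotProduct, Fin.sum_univ_succAbove _ i₀]
  have key' : ∀ v : Fin m → K, ∀ j, (v ᵥ* schurComplement A i₀ j₀) j =
      A i₀ j₀ * (∑ i, v i * A (i₀.succAbove i) (j₀.succAbove j)) -
        (∑ i, v i * A (i₀.succAbove i) j₀) * A i₀ (j₀.succAbove j) := fun v j => by
    rw [vecMul, dotProduct, Finset.mul_sum, Finset.sum_mul, ← Finset.sum_sub_distrib]
    refine Finset.sum_congr rfl fun i _ => ?_
    simp only [schurComplement, of_apply]
    ring
  constructor
  · rintro ⟨v, hv, hvA⟩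
    have h0 := fun j => (key v j).symm.trans (congrFun hvA j)
    refine ⟨v ∘ i₀.succAbove, fun hz => hv ?_, ?_⟩
    · have hz' : ∀ i, v (i₀.succAbove i) = 0 := congrFun hz
      have hi₀ : v i₀ = 0 := by
        have := h0 j₀
        simp only [hz', zero_mul, Finset.sum_const_zero, add_zero, Pi.zero_apply] at this
        exact (mul_eq_zero.1 this).resolve_right h
      ext i
      rcases Fin.eq_self_or_eq_succAbove i₀ i with rfl | ⟨i', rfl⟩
      · exact hi₀
      · exact hz' i'
    · ext j
      rw [key']
      have h1 := h0 j₀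
      have h2 := h0 (j₀.succAbove j)
      simp only [Pi.zero_apply, Function.comp_apply] at h1 h2 ⊢
      linear_combination A i₀ j₀ * h2 - A i₀ (j₀.succAbove j) * h1
  · rintro ⟨v, hv, hvA⟩
    have h0 := fun j => (key' v j).symm.trans (congrFun hvA j)
    refine ⟨i₀.insertNth (-∑ i, v i * A (i₀.succAbove i) j₀) (fun i => A i₀ j₀ * v i), ?_, ?_⟩
    · intro hz
      apply hv
      ext i
      have := congrFun hz (i₀.succAbove i)
      simp only [Fin.insertNth_apply_succAbove, Pi.zero_apply] at this
      exact (mul_eq_zero.1 this).resolve_left h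
    · ext j
      rw [key]
      simp only [Fin.insertNth_apply_succAbove, Fin.insertNth_apply_same, mul_assoc,
        ← Finset.mul_sum, Pi.zero_apply]
      rcases Fin.eq_self_or_eq_succAbove j₀ j with rfl | ⟨j', rfl⟩
      · ring
      · have := h0 j'
        simp only [Pi.zero_apply] at this
        linear_combination this

theorem minorsIdeal_le_prime_iff_schurComplement {R : Type*} [CommRing R] {m n : ℕ}
    (A : Matrix (Fin (m + 1)) (Fin (n + 1)) R) (i₀ : Fin (m + 1)) (j₀ : Fin (n + 1))
    (q : Ideal R) [q.IsPrime] (h : A i₀ j₀ ∉ q) :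
    minorsIdeal A ≤ q ↔ minorsIdeal (schurComplement A i₀ j₀) ≤ q := by
  rw [minorsIdeal_le_prime_iff, minorsIdeal_le_prime_iff,
    exists_vecMul_schurComplement_iff _ i₀ j₀]
  · have : schurComplement (A.map (algebraMap R q.ResidueField)) i₀ j₀ =
        (schurComplement A i₀ j₀).map (algebraMap R q.ResidueField) := by
      ext i j
      simp [schurComplement]
    rw [this]
  · rwa [map_apply, ne_eq, ← RingHom.mem_ker, Ideal.ker_algebraMap_residueField]

theorem mem_minimalPrimes_of_forall_iff {R : Type*} [CommRing R] {I J q : Ideal R}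
    (hq : q ∈ I.minimalPrimes)
    (h : ∀ (q' : Ideal R) [q'.IsPrime], q' ≤ q → (I ≤ q' ↔ J ≤ q')) : q ∈ J.minimalPrimes := by
  have := hq.1.1
  refine ⟨⟨hq.1.1, (h q le_rfl).1 hq.1.2⟩, fun q' hq' hle => ?_⟩
  have := hq'.1
  exact hq.2 ⟨hq'.1, (h q' hle).2 hq'.2⟩ hle

/-- Suppose a prime `P` over the minors of `B` is strictly inside `qR[X]`, and let `Q = q + (X)`.
Modulo `X` the matrix `B` becomes `A`, so minimality of `q` makes `Q` minimal over `P + (X)`.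
Krull's principal ideal theorem gives `Q/P` height at most one, contradicting the chain `P < qR[X] <
Q`. -/
theorem mem_minimalPrimes_map_C {R : Type*} [CommRing R] [IsNoetherianRing R] {m n : ℕ}
    (A : Matrix (Fin m) (Fin n) R) (B : Matrix (Fin m) (Fin n) R[X])
    (hB : ∀ i j, (B i j).eval 0 = A i j) {q : Ideal R} (hq : q ∈ (minorsIdeal A).minimalPrimes)
    (hle : minorsIdeal B ≤ q.map C) : q.map C ∈ (minorsIdeal B).minimalPrimes := by
  have hqp : q.IsPrime := hq.1.1
  have hqC : (q.map C).IsPrime := Ideal.isPrime_map_C_of_isPrime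
  refine ⟨⟨hqC, hle⟩, ?_⟩
  rintro P ⟨hP, hPB⟩ hPq
  by_contra hnot
  have hlt : P < q.map C := lt_of_le_not_ge hPq hnot
  let Q : Ideal R[X] := q.comap (evalRingHom 0)
  have hQ : Q.IsPrime := Ideal.comap_isPrime _ _
  have hqQ : q.map C ≤ Q := by
    rw [Ideal.map_le_iff_le_comap]
    intro x hx
    simpa [Q, Ideal.mem_comap] using hx
  have hXQ : (X : R[X]) ∈ Q := by simp [Q, Ideal.mem_comap]
  have hlt' : q.map C < Q := by
    refine lt_of_le_of_ne hqQ fun heq => hqp.ne_top ?_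
    rw [← heq, Ideal.mem_map_C_iff] at hXQ
    simpa [Ideal.eq_top_iff_one] using hXQ 1
  have hmin : Q ∈ (P ⊔ Ideal.span {X}).minimalPrimes := by
    refine ⟨⟨hQ, sup_le (hPq.trans hqQ) ((Ideal.span_singleton_le_iff_mem _).2 hXQ)⟩, ?_⟩
    rintro Q' ⟨hQ', hle'⟩ hQ'Q f hf
    have hX : (X : R[X]) ∈ Q' := hle' (Ideal.mem_sup_right (Ideal.mem_span_singleton_self X))
    have hdiv : ∀ g : R[X], C (g.eval 0) - g ∈ Q' := fun g => by
      have : X ∣ g - C (g.eval 0) := by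
        simpa using X_sub_C_dvd_sub_C_eval (a := (0 : R)) (p := g)
      obtain ⟨k, hk⟩ := this
      rw [← neg_sub, hk]
      exact Q'.neg_mem (Q'.mul_mem_right _ hX)
    have hA : minorsIdeal A ≤ Q'.comap C := by
      have h1 : minorsIdeal B ≤ Q' := hPB.trans (le_sup_left.trans hle')
      have e : (Q'.comap C : Ideal R) =
          RingHom.ker ((algebraMap R[X] Q'.ResidueField).comp C) := by
        rw [← RingHom.comap_ker, Ideal.ker_algebraMap_residueField]
      rw [minorsIdeal_le_prime_iff] at h1
      rw [e, minorsIdeal_le_ker_iff]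
      convert h1 using 5
      ext i j
      simp only [map_apply, RingHom.comp_apply, ← hB i j]
      rw [← sub_eq_zero, ← map_sub, ← RingHom.mem_ker, Ideal.ker_algebraMap_residueField]
      exact hdiv _
    have hcomap : Q'.comap C ≤ q := by
      intro x hx
      have := hQ'Q (Ideal.mem_comap.1 hx)
      simpa [Q, Ideal.mem_comap] using this
    have hq' : q ≤ Q'.comap C := hq.2 ⟨Ideal.comap_isPrime _ _, hA⟩ hcomap
    have h2 : C (f.eval 0) ∈ Q' := hq' hf
    have := Q'.sub_mem h2 (hdiv f)
    simpa using this
  have hone := Ideal.map_height_le_one_of_mem_minimalPrimes hmin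
  have hmapprime : ∀ (J : Ideal R[X]) [J.IsPrime], P ≤ J →
      (J.map (Ideal.Quotient.mk P)).IsPrime := fun J _ hJ =>
    Ideal.map_isPrime_of_surjective Ideal.Quotient.mk_surjective (by rwa [Ideal.mk_ker])
  have hmaplt : ∀ J J' : Ideal R[X], P ≤ J → J < J' →
      J.map (Ideal.Quotient.mk P) < J'.map (Ideal.Quotient.mk P) := by
    intro J J' hJ hlt
    refine lt_of_le_not_ge (Ideal.map_mono hlt.le) fun hge => hlt.not_ge ?_
    have := Ideal.comap_mono (f := Ideal.Quotient.mk P) hge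
    rwa [Ideal.comap_map_of_surjective' _ Ideal.Quotient.mk_surjective,
      Ideal.comap_map_of_surjective' _ Ideal.Quotient.mk_surjective, Ideal.mk_ker,
      sup_eq_left.2 hJ, sup_eq_left.2 (hJ.trans hlt.le)] at this
  have p1 := hmapprime P le_rfl
  have p2 := hmapprime (q.map C) hPq
  have p3 := hmapprime Q (hPq.trans hqQ)
  have a1 := Ideal.height_add_one_le_of_lt_of_isPrime (hmaplt _ _ le_rfl hlt)
  have a2 := Ideal.height_add_one_le_of_lt_of_isPrime (hmaplt _ _ hPq hlt')
  have : (2 : ℕ∞) ≤ 1 := calc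
    (2 : ℕ∞) = 0 + 1 + 1 := by norm_num
    _ ≤ (P.map (Ideal.Quotient.mk P)).height + 1 + 1 := by gcongr; exact zero_le
    _ ≤ ((q.map C).map (Ideal.Quotient.mk P)).height + 1 := by gcongr
    _ ≤ _ := a2.trans hone
  exact absurd this (by decide)

theorem height_le_height_map_C {R : Type*} [CommRing R] [IsNoetherianRing R] (q : Ideal R)
    [hq : q.IsPrime] : q.height ≤ (q.map (C : R →+* R[X])).height := by
  have : (q.map (C : R →+* R[X])).IsPrime := Ideal.isPrime_map_C_of_isPrime
  have : (q.map (C : R →+* R[X])).LiesOver q := ⟨by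
    rw [Ideal.under_def, algebraMap_eq]
    refine le_antisymm Ideal.le_comap_map fun x hx => ?_
    have := Ideal.mem_map_C_iff.1 (Ideal.mem_comap.1 hx) 0
    simpa using this⟩
  rw [Ideal.height_eq_height_add_of_liesOver_of_hasGoingDown q (q.map (C : R →+* R[X]))]
  exact le_self_add

/-- **The Eagon–Northcott height bound** for the maximal minors of a matrix. -/
theorem height_le_of_mem_minimalPrimes_minorsIdeal (m : ℕ) :
    ∀ {R : Type*} [CommRing R] [IsNoetherianRing R] {n : ℕ} (A : Matrix (Fin m) (Fin n) R)
      {q : Ideal R}, q ∈ (minorsIdeal A).minimalPrimes → m ≤ n →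
      q.height ≤ ((n + 1 - m : ℕ) : ℕ∞) := by
  induction m with
  | zero =>
    intro R _ _ n A q hq _
    -- The empty minor is `1`, so there is no minimal prime.
    have : (A.submatrix id Fin.elim0).det ∈ q := hq.1.2 (Ideal.subset_span ⟨Fin.elim0, rfl⟩)
    rw [show (A.submatrix id Fin.elim0).det = 1 from det_fin_zero] at this
    exact absurd ((Ideal.eq_top_iff_one q).2 this) hq.1.1.ne_top
  | succ m ih =>
    have step : ∀ {R : Type _} [CommRing R] [IsNoetherianRing R] {n : ℕ}
        (A : Matrix (Fin (m + 1)) (Fin n) R) {q : Ideal R}, q ∈ (minorsIdeal A).minimalPrimes →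
        m + 1 ≤ n → ∀ i₀ j₀, A i₀ j₀ ∉ q → q.height ≤ ((n + 1 - (m + 1) : ℕ) : ℕ∞) := by
      intro R _ _ n A q hq hn i₀ j₀ hA
      obtain ⟨n, rfl⟩ : ∃ n', n = n' + 1 := ⟨n - 1, by omega⟩
      have := ih (schurComplement A i₀ j₀) (mem_minimalPrimes_of_forall_iff hq fun q' _ hle =>
        minorsIdeal_le_prime_iff_schurComplement A i₀ j₀ q' fun h => hA (hle h)) (by omega)
      rwa [Nat.add_sub_add_right]
    intro R _ _ n A q hq hn
    by_cases hA : ∃ i₀ j₀, A i₀ j₀ ∉ q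
    · obtain ⟨i₀, j₀, h⟩ := hA
      exact step A hq hn i₀ j₀ h
    push Not at hA
    have hqp : q.IsPrime := hq.1.1
    rcases Nat.eq_zero_or_pos m with rfl | hm
    · have hq' : q ∈ (Ideal.span (Set.range (A 0))).minimalPrimes := by
        convert hq using 2
        rw [minorsIdeal]
        congr 1
        ext x
        have hdet : ∀ s : Fin 1 → Fin n, (A.submatrix id s).det = A 0 (s 0) := fun s => det_fin_one _
        exact ⟨fun ⟨j, hj⟩ => ⟨fun _ => j, (hdet _).trans hj⟩,
          fun ⟨s, hs⟩ => ⟨s 0, (hdet s).symm.trans hs⟩⟩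
      refine (Ideal.height_le_card_of_mem_minimalPrimes_span (Set.finite_range _) hq').trans ?_
      have h1 : (Set.range (A 0)).ncard ≤ n := by
        rw [← Set.image_univ]
        refine (Set.ncard_image_le Set.finite_univ).trans ?_
        simp
      exact_mod_cast h1
    · obtain ⟨n, rfl⟩ : ∃ n', n = n' + 1 := ⟨n - 1, by omega⟩
      -- All entries lie in `q`, so there is no pivot. Adding `X` to one entry creates a pivot
      -- outside `qR[X]`, while a second row still vanishes modulo `qR[X]` and keeps the minors
      -- inside it.
      let B : Matrix (Fin (m + 1)) (Fin (n + 1)) R[X] := A.map C + Matrix.single 0 0 X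
      have hqC : (q.map (C : R →+* R[X])).IsPrime := Ideal.isPrime_map_C_of_isPrime
      have hmem : ∀ i j, C (A i j) ∈ q.map (C : R →+* R[X]) := fun i j =>
        Ideal.mem_map_of_mem _ (hA i j)
      have hX : (X : R[X]) ∉ q.map (C : R →+* R[X]) := fun hX => by
        rw [Ideal.mem_map_C_iff] at hX
        exact hqp.ne_top (by simpa [Ideal.eq_top_iff_one] using hX 1)
      have hB : minorsIdeal B ≤ q.map C := by
        rw [minorsIdeal_le_prime_iff]
        obtain ⟨m, rfl⟩ : ∃ m', m = m' + 1 := ⟨m - 1, by omega⟩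
        refine ⟨Pi.single 1 1, by simp, ?_⟩
        ext j
        rw [single_one_vecMul]
        have h0 : algebraMap R[X] (q.map (C : R →+* R[X])).ResidueField (C (A 1 j)) = 0 := by
          rw [← RingHom.mem_ker, Ideal.ker_algebraMap_residueField]
          exact hmem _ _
        simpa [B, Matrix.single] using h0
      have hmin := mem_minimalPrimes_map_C A B (fun i j => by
        simp only [B, Matrix.single, Matrix.add_apply, map_apply, of_apply, eval_add, eval_C]
        split_ifs <;> simp) hq hB
      refine (height_le_height_map_C q).trans (step B hmin hn 0 0 fun h => hX ?_)
      have h2 := Ideal.sub_mem _ h (hmem 0 0)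
      simpa [B] using h2

/-- If the columns of `A` satisfy a linear relation whose `j₀`-th coefficient lies outside of a
minimal prime `q` over the maximal minors, then the height bound improves by one. -/
theorem height_le_of_mulVec_eq_zero {R : Type*} [CommRing R] [IsNoetherianRing R] {m n : ℕ}
    (A : Matrix (Fin m) (Fin (n + 1)) R) {q : Ideal R} (hq : q ∈ (minorsIdeal A).minimalPrimes)
    (y : Fin (n + 1) → R) (hy : A *ᵥ y = 0) (j₀ : Fin (n + 1)) (hj : y j₀ ∉ q) (hmn : m ≤ n) :
    q.height ≤ ((n + 1 - m : ℕ) : ℕ∞) := by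
  -- Near `q` the coefficient `y j₀` is invertible, so column `j₀` is a combination of the others
  -- and can be dropped.
  refine height_le_of_mem_minimalPrimes_minorsIdeal m (A.submatrix id j₀.succAbove)
    (mem_minimalPrimes_of_forall_iff hq fun q' _ hle => ?_) hmn
  rw [minorsIdeal_le_prime_iff, minorsIdeal_le_prime_iff]
  set φ := algebraMap R q'.ResidueField
  have hφ : φ (y j₀) ≠ 0 := by
    rw [ne_eq, ← RingHom.mem_ker, Ideal.ker_algebraMap_residueField]
    exact fun h => hj (hle h)
  refine exists_congr fun v => and_congr_right fun _ => ⟨fun h => ?_, fun h => ?_⟩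
  · ext j
    exact congrFun h (j₀.succAbove j)
  · have h0 : ∀ j, (v ᵥ* A.map φ) (j₀.succAbove j) = 0 := fun j => congrFun h j
    have hdot : (v ᵥ* A.map φ) ⬝ᵥ (φ ∘ y) = 0 := by
      rw [← dotProduct_mulVec]
      have : A.map φ *ᵥ (φ ∘ y) = 0 := by
        ext i
        rw [← RingHom.map_mulVec, hy]
        simp
      rw [this, dotProduct_zero]
    ext j
    rcases Fin.eq_self_or_eq_succAbove j₀ j with rfl | ⟨j', rfl⟩
    · rw [dotProduct, Fin.sum_univ_succAbove _ j] at hdot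
      simp only [h0, zero_mul, Finset.sum_const_zero, add_zero] at hdot
      exact (mul_eq_zero.1 hdot).resolve_right hφ
    · exact h0 j'

end KoszulProjDimOne

/-! ### Regular pairs, alternating forms and Cramer's rule -/

namespace KoszulProjDimOne

open Module

section Regular

variable {R : Type*} [CommRing R] {M : Type*} [AddCommGroup M] [Module R M]

/-- `a, b` is a weakly regular sequence on `M`, in terms of elements. -/
structure IsRegularPair (M : Type*) [AddCommGroup M] [Module R M] (a b : R) : Prop where
  left : ∀ x : M, a • x = 0 → x = 0
  right : ∀ x y : M, b • x = a • y → ∃ z, x = a • z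

theorem exists_isRegularPair {I : Ideal R} (h : 2 ≤ idealGrade I) :
    ∃ a ∈ I, ∃ b ∈ I, IsRegularPair R a b := by
  obtain ⟨a, ha, b, hb, h1, h2⟩ := exists_regular_pair_of_two_le_idealGrade h
  refine ⟨a, ha, b, hb, fun x hx => h1 x hx, fun x y hxy => ?_⟩
  obtain ⟨z, hz⟩ := Ideal.mem_span_singleton'.1 (h2 x (Ideal.mem_span_singleton'.2
    ⟨y, by rw [smul_eq_mul, smul_eq_mul] at hxy; rw [hxy, mul_comm]⟩))
  exact ⟨z, by rw [← hz, smul_eq_mul, mul_comm]⟩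

/-- An ideal containing a regular pair on `M` has `Hom(I, M) = M`: two proportional families can be
divided. -/
theorem exists_smul_eq_of_proportional {X : Type*} (f : X → R) (g : X → M)
    (hfg : ∀ x y, f x • g y = f y • g x) {a b : R} (ha : a ∈ Ideal.span (Set.range f))
    (hb : b ∈ Ideal.span (Set.range f)) (hab : IsRegularPair M a b) :
    ∃ z, ∀ x, g x = f x • z := by
  -- `β` plays the role of `c • z` for the quotient `z` still to be found.
  have hβ : ∀ c ∈ Ideal.span (Set.range f), ∃ β, ∀ x, f x • β = c • g x := by
    intro c hc
    induction hc using Submodule.span_induction with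
    | mem c hc =>
      obtain ⟨y, rfl⟩ := hc
      exact ⟨g y, fun x => hfg x y⟩
    | zero => exact ⟨0, by simp⟩
    | add c d _ _ hc hd =>
      obtain ⟨β, hβ⟩ := hc
      obtain ⟨γ, hγ⟩ := hd
      exact ⟨β + γ, fun x => by rw [smul_add, hβ, hγ, add_smul]⟩
    | smul r c _ hc =>
      obtain ⟨β, hβ⟩ := hc
      exact ⟨r • β, fun x => by rw [smul_comm, hβ, smul_assoc]⟩
  have hkill : ∀ m : M, (∀ x, f x • m = 0) → m = 0 := by
    intro m hm
    have h : Ideal.span (Set.range f) ≤ LinearMap.ker (LinearMap.toSpanSingleton R M m) :=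
      Ideal.span_le.2 (Set.range_subset_iff.2 hm)
    exact hab.left m (h ha)
  obtain ⟨β, hβa⟩ := hβ a ha
  obtain ⟨γ, hγb⟩ := hβ b hb
  have heq : b • β = a • γ := by
    rw [← sub_eq_zero]
    refine hkill _ fun x => ?_
    rw [smul_sub, smul_comm, hβa, smul_comm (f x) a, hγb, smul_comm, sub_self]
  obtain ⟨z, rfl⟩ := hab.right β γ heq
  refine ⟨z, fun x => ?_⟩
  rw [← sub_eq_zero]
  apply hab.left
  rw [smul_sub, ← hβa, smul_comm, sub_self]

end Regular

section Alternating

variable {R : Type*} [CommRing R] {N P : Type*} [AddCommGroup N] [Module R N]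
  [AddCommGroup P] [Module R P] {ι : Type*}

theorem alternating_eq_of_sub_mem [Finite ι] (f : N [⋀^ι]→ₗ[R] P) (K : Submodule R N)
    (hK : ∀ v i, v i ∈ K → f v = 0) (v w : ι → N) (h : ∀ i, v i - w i ∈ K) : f v = f w := by
  classical
  have : Fintype ι := Fintype.ofFinite ι
  have key : ∀ s : Finset ι, f (fun i => if i ∈ s then v i else w i) = f w := by
    intro s
    induction s using Finset.induction_on with
    | empty => simp
    | insert j s hj ih =>
      rw [← ih]
      set u := fun i => if i ∈ s then v i else w i
      have h1 : (fun i => if i ∈ insert j s then v i else w i) =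
          Function.update u j ((v j - w j) + u j) := by
        ext i
        by_cases hi : i = j
        · subst hi; simp [u, hj]
        · simp [u, hi]
      rw [h1, f.map_update_add, Function.update_eq_self, hK _ j (by simpa using h j), zero_add]
  have := key Finset.univ
  simpa using this

/-- An alternating form that vanishes when an argument lies in the kernel of a surjection descends
along the surjection. -/
theorem exists_alternating_comp_eq [Finite ι] {M : Type*} [AddCommGroup M] [Module R M]
    (f : N [⋀^ι]→ₗ[R] P) (π : N →ₗ[R] M) (hπ : Function.Surjective π)
    (hK : ∀ v i, π (v i) = 0 → f v = 0) : ∃ g : M [⋀^ι]→ₗ[R] P, ∀ v, g (π ∘ v) = f v := by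
  have hinv : ∀ v w : ι → N, π ∘ v = π ∘ w → f v = f w := fun v w h =>
    alternating_eq_of_sub_mem f (LinearMap.ker π) (fun v i hi => hK v i hi) v w fun i => by
      rw [LinearMap.mem_ker, map_sub, sub_eq_zero]
      exact congrFun h i
  let σ := Function.surjInv hπ
  have hσ : ∀ x, π (σ x) = x := Function.surjInv_eq hπ
  refine ⟨
    { toFun := fun v => f (σ ∘ v)
      map_update_add' := ?_
      map_update_smul' := ?_
      map_eq_zero_of_eq' := ?_ }, ?_⟩
  · intro _ v i x y
    have h : ∀ z, f (σ ∘ Function.update v i z) = f (Function.update (σ ∘ v) i (σ z)) :=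
      fun z => by rw [Function.comp_update]
    rw [h, h, h, ← f.map_update_add]
    apply hinv
    rw [Function.comp_update, Function.comp_update, map_add, hσ, hσ, hσ]
  · intro _ v i c x
    have h : ∀ z, f (σ ∘ Function.update v i z) = f (Function.update (σ ∘ v) i (σ z)) :=
      fun z => by rw [Function.comp_update]
    rw [h, h, ← f.map_update_smul]
    apply hinv
    rw [Function.comp_update, Function.comp_update, map_smul, hσ, hσ]
  · intro v i j hij hne
    exact f.map_eq_zero_of_eq _ (by simp [hij]) hne
  · intro v
    apply hinv
    ext i
    exact hσ _

theorem exists_alternating_mul_eq (f : N [⋀^ι]→ₗ[R] R) {c : R} (hc : ∀ x, c * x = 0 → x = 0)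
    (h : ∀ v, ∃ z, f v = c * z) : ∃ g : N [⋀^ι]→ₗ[R] R, ∀ v, f v = c * g v := by
  let μ := LinearMap.mulLeft R c
  have hμ : Function.Injective μ := by
    rw [injective_iff_map_eq_zero]
    exact hc
  let f' := f.codRestrict (LinearMap.range μ) fun v => by
    obtain ⟨z, hz⟩ := h v
    exact ⟨z, hz.symm⟩
  refine ⟨(LinearEquiv.ofInjective μ hμ).symm.toLinearMap.compAlternatingMap f', fun v => ?_⟩
  have := congrArg Subtype.val ((LinearEquiv.ofInjective μ hμ).apply_symm_apply (f' v))
  exact this.symm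

variable [Fintype ι] [DecidableEq ι]

/-- Both sides are alternating in the columns of `A`, so it suffices to compare them on the standard
basis. -/
theorem alternating_sum_smul (b : N [⋀^ι]→ₗ[R] P) (A : Matrix ι ι R) (w : ι → N) :
    b (fun j => ∑ i, A i j • w i) = A.det • b w := by
  let L : (ι → R) →ₗ[R] N := Fintype.linearCombination R w
  have h : b.compLinearMap L = Matrix.detRowAlternating.smulRight (b w) := by
    refine (Pi.basisFun R ι).ext_alternating fun v hv => ?_
    let σ : Equiv.Perm ι := Equiv.ofBijective v (Finite.injective_iff_bijective.1 hv)
    change (b.compLinearMap L) ((Pi.basisFun R ι) ∘ σ) =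
      (Matrix.detRowAlternating.smulRight (b w)) ((Pi.basisFun R ι) ∘ σ)
    rw [AlternatingMap.map_perm, AlternatingMap.map_perm]
    congr 1
    have h1 : (Matrix.detRowAlternating (R := R) (n := ι)) (Pi.basisFun R ι) = 1 := by
      rw [← Matrix.det_one (n := ι) (R := R)]
      change Matrix.det _ = Matrix.det _
      congr 1
      ext i j
      simp [Matrix.one_apply, Pi.single_apply, eq_comm]
    have h2 : L ∘ (Pi.basisFun R ι) = w := by
      ext i
      simp [L]
    have h3 : (Matrix.detRowAlternating.smulRight (b w)) (Pi.basisFun R ι) =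
      (Matrix.detRowAlternating (R := R) (n := ι)) (Pi.basisFun R ι) • b w := rfl
    rw [h3, h1, one_smul]
    change b (L ∘ (Pi.basisFun R ι)) = _
    rw [h2]
  have := DFunLike.congr_fun h A.transpose
  rw [← Matrix.det_transpose]
  exact this

end Alternating

section Cramer

variable {R : Type*} [CommRing R] {N P : Type*} [AddCommGroup N] [Module R N]
  [AddCommGroup P] [Module R P] {ι : Type*}

/-- The ideal generated by the values of an alternating form. -/
def valueIdeal (ω : N [⋀^ι]→ₗ[R] R) : Ideal R := Ideal.span (Set.range ω)

variable {ω : N [⋀^ι]→ₗ[R] R}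

theorem eq_zero_of_forall_smul_eq_zero {a : R} (ha : a ∈ valueIdeal ω)
    (hreg : ∀ x : P, a • x = 0 → x = 0) (z : P) (h : ∀ v, ω v • z = 0) : z = 0 := by
  have h : Ideal.span (Set.range ω) ≤ LinearMap.ker (LinearMap.toSpanSingleton R P z) :=
    Ideal.span_le.2 (Set.range_subset_iff.2 h)
  exact hreg z (h ha)

variable [DecidableEq ι]

/-- The `i`-th coordinate functional attached to a form and a family of vectors. -/
def coordForm (ω : N [⋀^ι]→ₗ[R] R) (v : ι → N) (i : ι) : N →ₗ[R] R :=
  ω.toMultilinearMap.toLinearMap v i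

@[simp] theorem coordForm_apply (ω : N [⋀^ι]→ₗ[R] R) (v : ι → N) (i : ι) (y : N) :
    coordForm ω v i y = ω (Function.update v i y) := rfl

theorem coordForm_family (ω : N [⋀^ι]→ₗ[R] R) (v : ι → N) (i j : ι) :
    coordForm ω v i (v j) = if i = j then ω v else 0 := by
  rw [coordForm_apply]
  split_ifs with h
  · subst h; rw [Function.update_eq_self]
  · exact ω.map_update_self v h

variable [Fintype ι]

/-- An alternating form that satisfies Cramer's rule. -/
def IsCramer (ω : N [⋀^ι]→ₗ[R] R) : Prop :=
  ∀ v y, ω v • y = ∑ i, ω (Function.update v i y) • v i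

theorem IsCramer.pow_smul (hω : IsCramer ω) (b : N [⋀^ι]→ₗ[R] P) (w v : ι → N) :
    ω w ^ Fintype.card ι • b v =
      (Matrix.of fun i j => ω (Function.update w i (v j))).det • b w := by
  rw [← alternating_sum_smul, ← Finset.card_univ, ← Finset.prod_const, ← b.map_smul_univ]
  congr 1
  ext j
  exact hω w (v j)

/-- After multiplication by `ω w ^ (2 * card ι)`, both products become the product of the two
coordinate determinants of `u` and `v` with `ω w * b w`, which is symmetric in `u` and `v`. So the
difference is killed by a power of the regular element `a`. -/
theorem IsCramer.mul_apply_comm (hω : IsCramer ω) {a : R} (ha : a ∈ valueIdeal ω)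
    (hreg : ∀ x, a * x = 0 → x = 0) (b : N [⋀^ι]→ₗ[R] R) (u v : ι → N) :
    ω u * b v = ω v * b u := by
  set z := ω u * b v - ω v * b u with hz
  let J : Ideal R := LinearMap.ker (LinearMap.toSpanSingleton R R z)
  have hle : valueIdeal ω ≤ J.radical := by
    refine Ideal.span_le.2 (Set.range_subset_iff.2 fun w => ?_)
    refine ⟨Fintype.card ι + Fintype.card ι, ?_⟩
    have hu := hω.pow_smul ω w u
    have hv := hω.pow_smul ω w v
    have hu' := hω.pow_smul b w u
    have hv' := hω.pow_smul b w v
    simp only [smul_eq_mul] at hu hv hu' hv'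
    rw [LinearMap.mem_ker, LinearMap.toSpanSingleton_apply, smul_eq_mul, pow_add, hz]
    linear_combination (ω w ^ Fintype.card ι * b v) * hu +
      (Matrix.of fun i j => ω (Function.update w i (u j))).det * ω w * hv' -
      (ω w ^ Fintype.card ι * b u) * hv -
      (Matrix.of fun i j => ω (Function.update w i (v j))).det * ω w * hu'
  obtain ⟨k, hk⟩ := hle ha
  rw [LinearMap.mem_ker, LinearMap.toSpanSingleton_apply, smul_eq_mul] at hk
  have : ∀ k : ℕ, a ^ k * z = 0 → z = 0 := by
    intro k
    induction k with
    | zero => simp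
    | succ k ih => exact fun h => ih (hreg _ (by rw [← h]; ring))
  exact sub_eq_zero.1 (this k hk)

/-- Over an ideal of values of grade at least two, a Cramer form generates the alternating forms. -/
theorem IsCramer.exists_eq_smul (hω : IsCramer ω) (h2 : 2 ≤ idealGrade (valueIdeal ω))
    (b : N [⋀^ι]→ₗ[R] R) : ∃ c : R, b = c • ω := by
  obtain ⟨a, ha, a', ha', hreg⟩ := exists_isRegularPair h2
  obtain ⟨c, hc⟩ := exists_smul_eq_of_proportional ω b
    (fun x y => hω.mul_apply_comm ha hreg.left b x y) ha ha' hreg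
  refine ⟨c, ?_⟩
  ext v
  rw [hc v, AlternatingMap.smul_apply, smul_eq_mul, smul_eq_mul, mul_comm]

/-- The coefficients in Cramer's rule are functionals of `y`, so they vanish as soon as `c` is a
nonzerodivisor of `R`. -/
theorem IsCramer.eq_zero_of_smul_eq_zero (hω : IsCramer ω) {a : R} (ha : a ∈ valueIdeal ω)
    (hreg : ∀ x : N, a • x = 0 → x = 0) {c : R} (hc : ∀ x, c * x = 0 → x = 0) {y : N}
    (hy : c • y = 0) : y = 0 := by
  refine eq_zero_of_forall_smul_eq_zero ha hreg y fun v => ?_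
  rw [hω v y]
  refine Finset.sum_eq_zero fun i _ => ?_
  have : coordForm ω v i y = 0 := hc _ (by rw [← smul_eq_mul, ← map_smul, hy, map_zero])
  rw [coordForm_apply] at this
  rw [this, zero_smul]

theorem IsCramer.eq_zero_of_forall_dual (hω : IsCramer ω) {a : R} (ha : a ∈ valueIdeal ω)
    (hreg : ∀ x : N, a • x = 0 → x = 0) {y : N} (hy : ∀ φ : Dual R N, φ y = 0) : y = 0 := by
  refine eq_zero_of_forall_smul_eq_zero ha hreg y fun v => ?_
  rw [hω v y]
  refine Finset.sum_eq_zero fun i _ => ?_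
  rw [← coordForm_apply, hy, zero_smul]

theorem IsCramer.isReflexive (hω : IsCramer ω) {a b c : R} (ha : a ∈ valueIdeal ω)
    (hb : b ∈ valueIdeal ω) (hab : IsRegularPair N a b) (hc : c ∈ valueIdeal ω)
    (hreg : ∀ x, c * x = 0 → x = 0) : IsReflexive R N := by
  refine ⟨(injective_iff_map_eq_zero _).2 fun y hy => hω.eq_zero_of_forall_dual ha hab.left
    fun φ => LinearMap.congr_fun hy φ, fun ξ => ?_⟩
  -- If `ξ` is evaluation at `z`, Cramer's rule says `g v = ω v • z`; so `z` is recovered by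
  -- dividing `g` by `ω`.
  let g : (ι → N) → N := fun v => ∑ i, ξ (coordForm ω v i) • v i
  have hg : ∀ (φ : Dual R N) v, φ (g v) = ω v * ξ φ := by
    intro φ v
    have h : ω v • φ = ∑ i, φ (v i) • coordForm ω v i := by
      ext y
      rw [LinearMap.smul_apply, ← map_smul, hω v y, map_sum]
      simp [mul_comm]
    rw [← smul_eq_mul, ← map_smul ξ, h, map_sum, map_sum]
    simp [mul_comm]
  obtain ⟨z, hz⟩ := exists_smul_eq_of_proportional ω g (fun v w => by
    rw [← sub_eq_zero]
    refine hω.eq_zero_of_forall_dual ha hab.left fun φ => ?_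
    rw [map_sub, map_smul, map_smul, hg, hg, smul_eq_mul, smul_eq_mul]
    ring) ha hb hab
  refine ⟨z, ?_⟩
  ext φ
  rw [← sub_eq_zero]
  refine eq_zero_of_forall_smul_eq_zero hc hreg _ fun v => ?_
  have := hg φ v
  rw [hz, map_smul, smul_eq_mul] at this
  rw [Dual.eval_apply, smul_eq_mul, mul_sub, this, sub_self]

/-- The kernel of a functional whose image contains a non-zero-divisor inherits reflexivity. -/
theorem isReflexive_ker [IsReflexive R N] (χ : N →ₗ[R] R) {x₀ : N}
    (hx₀ : ∀ x, χ x₀ * x = 0 → x = 0) : IsReflexive R (LinearMap.ker χ) := by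
  set U := LinearMap.ker χ
  have hN := bijective_dual_eval R N
  refine ⟨(injective_iff_map_eq_zero _).2 fun u hu => ?_, fun ξ => ?_⟩
  · have : (u : N) = 0 := (injective_iff_map_eq_zero _).1 hN.1 _ <| by
      ext φ
      exact LinearMap.congr_fun hu (φ ∘ₗ U.subtype)
    exact Subtype.ext this
  · let res : Dual R N →ₗ[R] Dual R U := LinearMap.lcomp R R U.subtype
    obtain ⟨z, hz⟩ := hN.2 (ξ ∘ₗ res)
    have hz' : ∀ φ : Dual R N, φ z = ξ (φ ∘ₗ U.subtype) := fun φ => LinearMap.congr_fun hz φ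
    have hzU : z ∈ U := by
      rw [LinearMap.mem_ker, hz' χ]
      convert map_zero ξ
      ext u
      exact u.2
    refine ⟨⟨z, hzU⟩, ?_⟩
    ext φ
    -- A functional on `U` need not extend to `N`, but its multiple by `χ x₀` does, through this
    -- map, which is multiplication by `χ x₀` on `U`.
    let π : N →ₗ[R] U := LinearMap.codRestrict U (χ x₀ • LinearMap.id - χ.smulRight x₀) fun y => by
      rw [LinearMap.mem_ker]
      simp [mul_comm]
    have hπ : (φ ∘ₗ π) ∘ₗ U.subtype = χ x₀ • φ := by
      ext u
      have : π u = χ x₀ • u := by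
        apply Subtype.ext
        have hu : χ u = 0 := u.2
        simp [π, hu]
      simp [this]
    have h1 := hz' (φ ∘ₗ π)
    rw [hπ, map_smul] at h1
    have h2 : (φ ∘ₗ π) z = χ x₀ • φ ⟨z, hzU⟩ := LinearMap.congr_fun hπ ⟨z, hzU⟩
    rw [h2] at h1
    rw [Dual.eval_apply, ← sub_eq_zero]
    apply hx₀
    rw [mul_sub, sub_eq_zero]
    exact h1

end Cramer

end KoszulProjDimOne

/-! ### Dividing a Cramer form by a functional -/

namespace KoszulProjDimOne

open Module

variable {R : Type*} [CommRing R] {N : Type*} [AddCommGroup N] [Module R N] {k : ℕ}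

theorem map_vecCons_smul_sub (ω : N [⋀^Fin (k + 1)]→ₗ[R] R) (x : N) (t : R) (c : Fin k → R)
    (w : Fin k → N) :
    ω (Matrix.vecCons x fun j => t • w j - c j • x) = t ^ k * ω (Matrix.vecCons x w) := by
  have h := alternating_eq_of_sub_mem (ω.curryLeft x) (R ∙ x) (fun v i hi => by
    obtain ⟨d, hd⟩ := Submodule.mem_span_singleton.1 hi
    have hv : v = Function.update v i (d • x) := by rw [hd, Function.update_eq_self]
    rw [hv, AlternatingMap.map_update_smul, AlternatingMap.curryLeft_apply_apply,
      ω.map_eq_zero_of_eq (i := 0) (j := i.succ) _ (by simp) (Fin.succ_ne_zero i).symm, smul_zero])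
    (fun j => t • w j - c j • x) (fun j => t • w j) (fun i => by
      refine Submodule.mem_span_singleton.2 ⟨-c i, ?_⟩
      rw [sub_sub_cancel_left, neg_smul])
  rw [AlternatingMap.curryLeft_apply_apply] at h
  rw [h, AlternatingMap.map_smul_univ, AlternatingMap.curryLeft_apply_apply]
  simp

variable {ω : N [⋀^Fin (k + 1)]→ₗ[R] R}

theorem IsCramer.mul_map (hω : IsCramer ω) (χ : N →ₗ[R] R) (v : Fin (k + 1) → N) (y : N) :
    ω v * χ y = ∑ i, ω (Function.update v i y) * χ (v i) := by
  simpa using congrArg χ (hω v y)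

/-- Apply `χ` to Cramer's rule for the family `(y, u)` and the vector `x`; every term but the first
contains some `χ (u i) = 0`. -/
theorem IsCramer.vecCons_proportional (hω : IsCramer ω) (χ : N →ₗ[R] R) (u : Fin k → LinearMap.ker χ) (x y : N) :
    χ x * ω (Matrix.vecCons y fun i => (u i : N)) =
      χ y * ω (Matrix.vecCons x fun i => (u i : N)) := by
  have h := hω.mul_map χ (Matrix.vecCons y fun i => (u i : N)) x
  rw [Fin.sum_univ_succ] at h
  have h0 : ∀ i, χ (u i) = 0 := fun i => (u i).2
  simp only [Matrix.cons_val_zero, Matrix.cons_val_succ, h0, mul_zero, Finset.sum_const_zero,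
    add_zero] at h
  rw [mul_comm, h, mul_comm]
  congr 2
  exact Fin.update_cons_zero (α := fun _ => N) y (fun i => (u i : N)) x

/-- The form on the kernel of `χ` obtained by dividing `ω` by `χ`. -/
theorem IsCramer.exists_form_ker (hω : IsCramer ω) (χ : N →ₗ[R] R) (hχ : 2 ≤ idealGrade (LinearMap.range χ)) :
    ∃ a : LinearMap.ker χ [⋀^Fin k]→ₗ[R] R, ∀ x u,
      ω (Matrix.vecCons x fun i => (u i : N)) = χ x * a u := by
  obtain ⟨a, ha, b, hb, hab⟩ := exists_isRegularPair hχ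
  have hspan : ∀ c ∈ LinearMap.range χ, c ∈ Ideal.span (Set.range χ) := fun c hc =>
    Ideal.subset_span hc
  have hz : ∀ u : Fin k → LinearMap.ker χ, ∃ z, ∀ x,
      ω (Matrix.vecCons x fun i => (u i : N)) = χ x • z := fun u =>
    exists_smul_eq_of_proportional χ _ (fun x y => hω.vecCons_proportional χ u x y)
      (hspan a ha) (hspan b hb) hab
  obtain ⟨x₀, rfl⟩ := ha
  have hreg : ∀ x, χ x₀ * x = 0 → x = 0 := hab.left
  obtain ⟨g, hg⟩ := exists_alternating_mul_eq
    ((ω.curryLeft x₀).compLinearMap (LinearMap.ker χ).subtype) hreg fun u => by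
      obtain ⟨z, hz⟩ := hz u
      exact ⟨z, hz x₀⟩
  refine ⟨g, fun x u => ?_⟩
  obtain ⟨z, hz⟩ := hz u
  have h1 : χ x₀ * z = χ x₀ * g u := (hz x₀).symm.trans (hg u)
  have : z = g u := sub_eq_zero.1 (hreg _ (by rw [mul_sub, h1, sub_self]))
  rw [hz x, this, smul_eq_mul]

variable {χ : N →ₗ[R] R} {a : LinearMap.ker χ [⋀^Fin k]→ₗ[R] R}

/-- In Cramer's rule for `(x₀, u)` and `y` in the kernel, the coefficient of `x₀` is `χ y * a u =
0`, and all other terms share the factor `χ x₀`, which cancels. -/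
theorem IsCramer.form_ker_isCramer (hω : IsCramer ω)
    (ha : ∀ x u, ω (Matrix.vecCons x fun i => (u i : N)) = χ x * a u) {x₀ : N} (hreg : ∀ y : N, χ x₀ • y = 0 → y = 0) :
    IsCramer a := by
  intro u y
  apply Subtype.ext
  rw [← sub_eq_zero]
  apply hreg
  have h := hω (Matrix.vecCons x₀ fun i => (u i : N)) y
  rw [Fin.sum_univ_succ] at h
  have h0 : ω (Function.update (Matrix.vecCons x₀ fun i => (u i : N)) 0 (y : N)) = 0 := by
    rw [show Function.update (Matrix.vecCons x₀ fun i => (u i : N)) 0 (y : N) =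
      Matrix.vecCons (y : N) fun i => (u i : N) from Fin.update_cons_zero (α := fun _ => N) _ _ _,
      ha, show χ y = 0 from y.2, zero_mul]
  have hs : ∀ i : Fin k,
      ω (Function.update (Matrix.vecCons x₀ fun i => (u i : N)) i.succ (y : N)) =
        χ x₀ * a (Function.update u i y) := fun i => by
    rw [← ha]
    congr 1
    rw [show Function.update (Matrix.vecCons x₀ fun i => (u i : N)) i.succ (y : N) =
      Matrix.vecCons x₀ (Function.update (fun i => (u i : N)) i y) from
      (Fin.cons_update (α := fun _ => N) x₀ (fun i => (u i : N)) i y).symm]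
    congr 1
    ext j
    by_cases hj : j = i
    · subst hj; simp
    · simp [hj]
  simp only [h0, hs, ha, zero_smul, zero_add, Matrix.cons_val_succ] at h
  rw [smul_sub, sub_eq_zero]
  simp only [Submodule.coe_smul, Submodule.coe_sum, Finset.smul_sum, smul_smul]
  exact h

/-- Away from the image of `χ` and from the values of `ω`, the form on the kernel takes a unit
value. -/
theorem IsCramer.exists_form_ker_notMem (hω : IsCramer ω)
    (ha : ∀ x u, ω (Matrix.vecCons x fun i => (u i : N)) = χ x * a u) {p : Ideal R} [p.IsPrime] {x : N} (hx : χ x ∉ p)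
    {v : Fin (k + 1) → N} (hv : ω v ∉ p) : ∃ u, a u ∉ p := by
  have h := hω.mul_map χ v x
  -- The left side of `h` is outside `p`, so `x` can replace some `v i` with the value of `ω` still
  -- outside `p`.
  obtain ⟨i, -, hi⟩ : ∃ i ∈ Finset.univ, ω (Function.update v i x) * χ (v i) ∉ p := by
    by_contra! hcon
    have := p.sum_mem hcon
    rw [← h] at this
    exact ((Ideal.IsPrime.mem_or_mem ‹_› this).elim hv hx)
  have hi' : ω (Function.update v i x) ∉ p := fun h => hi (p.mul_mem_right _ h)
  obtain ⟨w, hw⟩ : ∃ w : Fin k → N, ω (Matrix.vecCons x w) ∉ p := by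
    let σ := Equiv.swap 0 i
    refine ⟨Matrix.vecTail (Function.update v i x ∘ σ), ?_⟩
    have e : Matrix.vecCons x (Matrix.vecTail (Function.update v i x ∘ σ)) =
        Function.update v i x ∘ σ := by
      convert Matrix.cons_head_tail (Function.update v i x ∘ σ)
      simp [Matrix.vecHead, σ]
    rw [e, AlternatingMap.map_perm]
    rcases Int.units_eq_one_or (Equiv.Perm.sign σ) with hσ | hσ <;> rw [hσ]
    · simpa using hi'
    · simpa using hi'
  -- The remaining vectors are scaled and corrected by multiples of `x` to land in the kernel; this
  -- multiplies `ω` only by `χ x ^ k`.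
  let u : Fin k → LinearMap.ker χ := fun j => ⟨χ x • w j - χ (w j) • x, by
    rw [LinearMap.mem_ker, map_sub, map_smul, map_smul, smul_eq_mul, smul_eq_mul, mul_comm,
      sub_self]⟩
  refine ⟨u, fun hu => ?_⟩
  have h1 := ha x u
  rw [show (fun i => (u i : N)) = fun j => χ x • w j - χ (w j) • x from rfl,
    map_vecCons_smul_sub] at h1
  have h2 : χ x ^ k * ω (Matrix.vecCons x w) ∈ p := by
    rw [h1]
    exact p.mul_mem_left _ hu
  rcases Ideal.IsPrime.mem_or_mem ‹_› h2 with h2 | h2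
  · exact hx (Ideal.IsPrime.mem_of_pow_mem ‹_› _ h2)
  · exact hw h2

end KoszulProjDimOne

/-! ### The cokernel: its Cramer form, its depth and the upper bound on grade -/

namespace KoszulProjDimOne

open Module Matrix

theorem isCramer_basis_det {R N ι : Type*} [CommRing R] [AddCommGroup N] [Module R N] [Fintype ι]
    [DecidableEq ι] (e : Basis ι R N) : IsCramer e.det := by
  intro v y
  have h := mulVec_cramer (e.toMatrix v) (e.repr y)
  apply e.repr.injective
  ext i
  have hi := congrFun h i
  simp only [mulVec, dotProduct, Pi.smul_apply, smul_eq_mul, cramer_apply] at hi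
  rw [map_smul, Finsupp.smul_apply, smul_eq_mul, Basis.det_apply, ← hi, map_sum,
    Finsupp.finsetSum_apply]
  refine Finset.sum_congr rfl fun j _ => ?_
  rw [map_smul, Finsupp.smul_apply, smul_eq_mul, Basis.det_apply, Basis.toMatrix_update, mul_comm]
  rfl

/-- Fixing some of the arguments of an alternating form yields an alternating form. -/
def partialForm {R N ι κ : Type*} [CommRing R] [AddCommGroup N] [Module R N]
    (f : N [⋀^ι ⊕ κ]→ₗ[R] R) (u : ι → N) : N [⋀^κ]→ₗ[R] R where
  __ := f.toMultilinearMap.currySum u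
  map_eq_zero_of_eq' v i j hij hne := by
    change f (fun t => Sum.rec u v t) = 0
    exact f.map_eq_zero_of_eq _ (i := Sum.inr i) (j := Sum.inr j) hij
      (fun h => hne (Sum.inr_injective h))

theorem partialForm_apply {R N ι κ : Type*} [CommRing R] [AddCommGroup N] [Module R N]
    (f : N [⋀^ι ⊕ κ]→ₗ[R] R) (u : ι → N) (v : κ → N) : partialForm f u v = f (Sum.elim u v) :=
  congrArg f (by ext (i | i) <;> rfl)

section Cokernel

variable {R : Type*} [CommRing R] {m r : ℕ} {M : Type*} [AddCommGroup M] [Module R M]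
  (A : Matrix (Fin m) (Fin (m + r)) R) (π : (Fin (m + r) → R) →ₗ[R] M)

theorem exists_equiv_extending {m r : ℕ} {s : Fin m → Fin (m + r)} (hs : Function.Injective s) :
    ∃ σ : Fin m ⊕ Fin r ≃ Fin (m + r), ∀ i, σ (Sum.inl i) = s i := by
  classical
  have hcard : Fintype.card ((Set.range s)ᶜ : Set (Fin (m + r))) = r := by
    rw [Fintype.card_compl_set, Set.card_range_of_injective hs]
    simp
  refine ⟨(Equiv.sumCongr (Equiv.ofInjective s hs) (Fintype.equivFinOfCardEq hcard).symm).trans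
    (Equiv.Set.sumCompl (Set.range s)), fun i => ?_⟩
  simp

theorem det_sumElim_basis (σ : Fin m ⊕ Fin r ≃ Fin (m + r)) :
    ((Pi.basisFun R (Fin (m + r))).reindex σ.symm).det
      (Sum.elim A.row fun j => Pi.single (σ (Sum.inr j)) 1) =
        (A.submatrix id fun i => σ (Sum.inl i)).det := by
  rw [Basis.det_apply, ← det_transpose (A.submatrix _ _)]
  have : ((Pi.basisFun R (Fin (m + r))).reindex σ.symm).toMatrix
      (Sum.elim A.row fun j => Pi.single (σ (Sum.inr j)) 1) =
      fromBlocks (A.submatrix id fun i => σ (Sum.inl i))ᵀ 0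
        (A.submatrix id fun i => σ (Sum.inr i))ᵀ 1 := by
    ext (i | i) (j | j) <;>
      simp [Basis.toMatrix_apply, Matrix.one_apply, Pi.single_apply, row_apply]
  rw [this, det_fromBlocks_zero₁₂, det_one, mul_one]

/-- The cokernel of the transpose of an `m × (m + r)` matrix carries a Cramer form of degree `r`
whose values include the maximal minors. -/
theorem exists_cramer_form (hπ : Function.Surjective π) (hker : ∀ x, π x = 0 ↔ ∃ g, g ᵥ* A = x) :
    ∃ ω : M [⋀^Fin r]→ₗ[R] R, IsCramer ω ∧ minorsIdeal A ≤ valueIdeal ω := by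
  let e := (Pi.basisFun R (Fin (m + r))).reindex finSumFinEquiv.symm
  have hrow : ∀ i, π (A.row i) = 0 := fun i => (hker _).2 ⟨Pi.single i 1, by rw [single_one_vecMul]⟩
  -- With the rows of `A` in the first `m` slots, the determinant vanishes when another argument is
  -- in the row space, so it descends to `M`.
  obtain ⟨ω, hω⟩ := exists_alternating_comp_eq (partialForm e.det A.row) π hπ fun v i hi => by
    obtain ⟨g, hg⟩ := (hker _).1 hi
    have hv : v = Function.update v i (∑ l, g l • A.row l) := by
      rw [eq_comm, Function.update_eq_self_iff, ← hg]
      ext j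
      simp [vecMul, dotProduct, row_apply]
    rw [hv, AlternatingMap.map_update_sum]
    refine Finset.sum_eq_zero fun l _ => ?_
    rw [AlternatingMap.map_update_smul, partialForm_apply, e.det.map_eq_zero_of_eq
      (i := Sum.inl l) (j := Sum.inr i) _ (by simp) (by simp), smul_zero]
  refine ⟨ω, fun v y => ?_, ?_⟩
  · obtain ⟨v, rfl⟩ : ∃ v', v = π ∘ v' := ⟨fun i => (hπ (v i)).choose,
      funext fun i => ((hπ (v i)).choose_spec).symm⟩
    obtain ⟨y, rfl⟩ := hπ y
    have h := congrArg π (isCramer_basis_det e (Sum.elim A.row v) y)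
    rw [map_smul, map_sum, Fintype.sum_sum_type] at h
    simp only [map_smul, Sum.elim_inl, hrow, smul_zero, Finset.sum_const_zero, zero_add,
      Sum.elim_inr, Sum.update_elim_inr] at h
    rw [hω, partialForm_apply, h]
    refine Finset.sum_congr rfl fun i _ => ?_
    rw [← Function.comp_update, hω, partialForm_apply]
    rfl
  · refine Ideal.span_le.2 (Set.range_subset_iff.2 fun s => ?_)
    by_cases hs : Function.Injective s
    -- Unit vectors at the unselected columns turn the determinant into the chosen minor, up to the
    -- constant relating two bases.
    · obtain ⟨σ, hσ⟩ := exists_equiv_extending hs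
      have h1 := det_sumElim_basis A σ
      rw [AlternatingMap.eq_smul_basis_det e (Basis.det _), AlternatingMap.smul_apply,
        ← partialForm_apply e.det, ← hω] at h1
      simp only [hσ] at h1
      rw [SetLike.mem_coe]
      change (A.submatrix id fun i => s i).det ∈ _
      rw [← h1]
      exact Ideal.mul_mem_left _ _ (Ideal.subset_span ⟨_, rfl⟩)
    · rw [Function.not_injective_iff] at hs
      obtain ⟨i, j, hij, hne⟩ := hs
      have : (A.submatrix id s).det = 0 := det_zero_of_column_eq hne fun l => by simp [hij]
      rw [SetLike.mem_coe, this]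
      exact Ideal.zero_mem _

/-- Multiply `g ᵥ* A`, restricted to the columns of a minor, by the adjugate: the minors annihilate
the kernel of the transpose modulo `J`. -/
theorem mul_mem_of_vecMul_mem {m n : ℕ} (A : Matrix (Fin m) (Fin n) R) (J : Ideal R)
    {g : Fin m → R} (hg : ∀ j, (g ᵥ* A) j ∈ J) {d : R} (hd : d ∈ minorsIdeal A) (i : Fin m) :
    d * g i ∈ J := by
  induction hd using Submodule.span_induction with
  | mem d hd =>
    obtain ⟨s, rfl⟩ := hd
    have h : g ᵥ* (A.submatrix id s) ᵥ* (A.submatrix id s).adjugate =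
        (A.submatrix id s).det • g := by
      rw [vecMul_vecMul, mul_adjugate, vecMul_smul, vecMul_one]
    have hi := congrFun h i
    rw [Pi.smul_apply, smul_eq_mul] at hi
    rw [← hi]
    rw [vecMul, dotProduct]
    exact J.sum_mem fun j _ => J.mul_mem_right _ (hg (s j))
  | zero => simp
  | add c d _ _ hc hd => rw [add_mul]; exact J.add_mem hc hd
  | smul t c _ hc => rw [smul_eq_mul, mul_assoc]; exact J.mul_mem_left _ hc

/-- The presentation has length one, which costs one element of the sequence. A relation on `M`
lifts to a combination `g` of rows that vanishes modulo `a`, respectively `(a, b)`; the next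
element, being in the ideal of minors, forces `g` itself into that ideal, and the multiples can be
divided off. -/
theorem isRegularPair_cokernel (hπ : Function.Surjective π)
    (hker : ∀ x, π x = 0 ↔ ∃ g, g ᵥ* A = x) {a b c : R} (hb : b ∈ minorsIdeal A)
    (hc : c ∈ minorsIdeal A) (h1 : ∀ x, a * x = 0 → x = 0)
    (h2 : ∀ x, b * x ∈ Ideal.span {a} → x ∈ Ideal.span {a})
    (h3 : ∀ x, c * x ∈ Ideal.span {a, b} → x ∈ Ideal.span {a, b}) : IsRegularPair M a b where
  left x hx := by
    obtain ⟨x, rfl⟩ := hπ x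
    rw [← map_smul, hker] at hx
    obtain ⟨g, hg⟩ := hx
    have hmem : ∀ i, g i ∈ Ideal.span {a} := fun i => h2 _ (mul_mem_of_vecMul_mem A _ (fun j => by
      rw [hg]; exact Ideal.mem_span_singleton'.2 ⟨x j, mul_comm _ _⟩) hb i)
    choose g' hg' using fun i => Ideal.mem_span_singleton'.1 (hmem i)
    rw [hker]
    refine ⟨g', ?_⟩
    have hgg : g = a • g' := by ext i; rw [← hg', Pi.smul_apply, smul_eq_mul, mul_comm]
    rw [hgg, smul_vecMul] at hg
    ext j
    have hj := congrFun hg j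
    simp only [Pi.smul_apply, smul_eq_mul] at hj
    exact sub_eq_zero.1 (h1 _ (by rw [mul_sub, hj, sub_self]))
  right x y hxy := by
    obtain ⟨x, rfl⟩ := hπ x
    obtain ⟨y, rfl⟩ := hπ y
    rw [← sub_eq_zero, ← map_smul, ← map_smul, ← map_sub, hker] at hxy
    obtain ⟨g, hg⟩ := hxy
    have hmem : ∀ i, g i ∈ Ideal.span {a, b} := fun i => h3 _ (mul_mem_of_vecMul_mem A _ (fun j => by
      rw [hg]; exact Ideal.mem_span_pair.2 ⟨-y j, x j, by simp; ring⟩) hc i)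
    choose g₁ g₂ hg' using fun i => Ideal.mem_span_pair.1 (hmem i)
    have hgg : g = a • g₁ + b • g₂ := by
      ext i; rw [← hg']; simp [mul_comm]
    rw [hgg, add_vecMul, smul_vecMul, smul_vecMul] at hg
    have hmem' : ∀ j, ∃ z, z * a = x j - (g₂ ᵥ* A) j := fun j => by
      refine Ideal.mem_span_singleton'.1 (h2 _ (Ideal.mem_span_singleton'.2
        ⟨y j + (g₁ ᵥ* A) j, ?_⟩))
      have hj := congrFun hg j
      simp only [Pi.smul_apply, Pi.add_apply, Pi.sub_apply, smul_eq_mul] at hj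
      linear_combination hj
    choose z hz using hmem'
    refine ⟨π z, ?_⟩
    rw [← sub_eq_zero, ← map_smul, ← map_sub, hker]
    refine ⟨g₂, ?_⟩
    ext j
    have := hz j
    simp only [Pi.smul_apply, Pi.sub_apply, smul_eq_mul]
    linear_combination this

/-- The image of a functional on the cokernel has grade at most `r + 1` when the ideal of maximal
minors has grade `r + 1`. -/
theorem idealGrade_range_le [IsNoetherianRing R] (hπ : Function.Surjective π)
    (hker : ∀ x, π x = 0 ↔ ∃ g, g ᵥ* A = x) (hr : 1 ≤ r)
    (hg : idealGrade (minorsIdeal A) = (r : ℕ∞) + 1) (χ : M →ₗ[R] R) :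
    idealGrade (LinearMap.range χ) ≤ (r : ℕ∞) + 1 := by
  by_contra! hcon
  have hcon' : ((r + 2 : ℕ) : ℕ∞) ≤ idealGrade (LinearMap.range χ) := by
    have := Order.add_one_le_of_lt hcon
    push_cast
    rwa [add_assoc, one_add_one_eq_two] at this
  -- Some prime over the minors has grade below `r + 2`, so it cannot contain `Im χ`; a coefficient
  -- of the column relation `y` is then outside it.
  obtain ⟨p, hp, hIp, hpg⟩ : ∃ p : Ideal R, ∃ _ : p.IsPrime, minorsIdeal A ≤ p ∧
      ¬ ((r + 2 : ℕ) : ℕ∞) ≤ idealGrade p := by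
    by_contra! h
    have := natCast_le_idealGrade_of_forall_prime (I := minorsIdeal A) (k := r + 2)
      fun p _ hle => h p ‹_› hle
    rw [hg] at this
    have : r + 2 ≤ r + 1 := by exact_mod_cast this
    omega
  have hχp : ¬ LinearMap.range χ ≤ p := fun h => hpg (hcon'.trans (idealGrade_mono h))
  let y : Fin (m + r) → R := fun j => χ (π (Pi.single j 1))
  have hχπ : ∀ x, χ (π x) = ∑ j, x j * y j := fun x => by
    conv_lhs => rw [pi_eq_sum_univ' x]
    simp only [map_sum, map_smul, smul_eq_mul, y]
  obtain ⟨j, hj⟩ : ∃ j, y j ∉ p := by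
    by_contra! h
    apply hχp
    rintro _ ⟨x, rfl⟩
    obtain ⟨x, rfl⟩ := hπ x
    rw [hχπ]
    exact p.sum_mem fun j _ => p.mul_mem_left _ (h j)
  have hAy : A *ᵥ y = 0 := by
    ext i
    have h : π (A.row i) = 0 := (hker _).2 ⟨Pi.single i 1, by rw [single_one_vecMul]⟩
    rw [Pi.zero_apply, ← map_zero χ, ← h, hχπ]
    rfl
  obtain ⟨q, hq, hqp⟩ := Ideal.exists_minimalPrimes_le hIp
  have := hq.1.1
  have h1 : ((r + 1 : ℕ) : ℕ∞) ≤ q.height :=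
    natCast_le_height (by rw [hg]; push_cast; exact le_rfl) hq.1.2
  obtain ⟨r, rfl⟩ : ∃ r', r = r' + 1 := ⟨r - 1, by omega⟩
  have h2 := height_le_of_mulVec_eq_zero (n := m + r) A hq y hAy j (fun h => hj (hqp h)) (by omega)
  have h3 : r + 1 + 1 ≤ m + r + 1 - m := by exact_mod_cast h1.trans h2
  omega

end Cokernel

end KoszulProjDimOne

/-! ### Prime avoidance for forms, localization and rank -/

namespace KoszulProjDimOne

open Module

section Avoidance

variable {R : Type*} [CommRing R] {N : Type*} [AddCommGroup N] [Module R N] {ι : Type*} [Fintype ι]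

theorem map_smul_const (ω : N [⋀^ι]→ₗ[R] R) (c : R) (u : ι → N) :
    ω (c • u) = c ^ Fintype.card ι * ω u := by
  have := ω.map_smul_univ (fun _ => c) u
  rwa [Finset.prod_const, Finset.card_univ] at this

/-- Over a finite antichain of primes, a form with values outside each of the primes has a single
value outside all of them. -/
theorem exists_notMem_of_antichain (ω : N [⋀^ι]→ₗ[R] R) (T : Finset (Ideal R))
    (hT : ∀ p ∈ T, p.IsPrime) (hanti : ∀ p ∈ T, ∀ q ∈ T, p ≤ q → p = q)
    (h : ∀ p ∈ T, ∃ u, ω u ∉ p) : ∃ u, ∀ p ∈ T, ω u ∉ p := by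
  classical
  choose! u hu using h
  have he : ∀ p ∈ T, ∃ e, e ∉ p ∧ ∀ q ∈ T, q ≠ p → e ∈ q := by
    intro p hp
    by_contra! hcon
    have hle : (T.erase p).prod id ≤ p := fun e he => by
      by_contra hep
      obtain ⟨q, hq, hqp, heq⟩ := hcon e hep
      exact heq (Ideal.prod_le_inf.trans (Finset.inf_le (Finset.mem_erase.2 ⟨hqp, hq⟩)) he)
    obtain ⟨q, hq, hqp⟩ := (hT p hp).prod_le.1 hle
    rw [Finset.mem_erase] at hq
    exact hq.1 (hanti q hq.2 p hp hqp)
  choose! e he1 he2 using he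
  -- Modulo `p` only the summand of `p` survives, since `e q` lies in `p` for every other `q`.
  refine ⟨∑ p ∈ T, e p • u p, fun p hp hmem => ?_⟩
  have := hT p hp
  let f : N [⋀^ι]→ₗ[R] (R ⧸ p) := (Submodule.mkQ p).compAlternatingMap ω
  have hf : f (∑ q ∈ T, e q • u q) = f (e p • u p) := by
    refine alternating_eq_of_sub_mem f (p • (⊤ : Submodule R N)) ?_ _ _ fun i => ?_
    · intro v i hi
      have hle : p • (⊤ : Submodule R N) ≤ LinearMap.ker (f.toMultilinearMap.toLinearMap v i) := by
        refine Submodule.smul_le.2 fun c hc x _ => ?_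
        rw [LinearMap.mem_ker, map_smul]
        obtain ⟨d, hd⟩ := Submodule.mkQ_surjective p (f.toMultilinearMap.toLinearMap v i x)
        rw [← hd, ← map_smul, Submodule.mkQ_apply, Submodule.Quotient.mk_eq_zero]
        exact p.mul_mem_right _ hc
      have h0 := hle hi
      rw [LinearMap.mem_ker, MultilinearMap.toLinearMap_apply, Function.update_eq_self] at h0
      exact h0
    · rw [← Finset.add_sum_erase T _ hp, Pi.add_apply, add_sub_cancel_left, Finset.sum_apply]
      refine Submodule.sum_mem _ fun q hq => ?_
      rw [Finset.mem_erase] at hq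
      exact Submodule.smul_mem_smul (he2 q hq.2 p hp hq.1.symm) trivial
  have h0 : f (∑ q ∈ T, e q • u q) = 0 := (Submodule.Quotient.mk_eq_zero p).2 hmem
  rw [hf] at h0
  have h1 : ω (e p • u p) ∈ p := (Submodule.Quotient.mk_eq_zero p).1 h0
  rw [map_smul_const] at h1
  rcases this.mem_or_mem h1 with h1 | h1
  · exact he1 p hp (this.mem_of_pow_mem _ h1)
  · exact hu p hp h1

theorem exists_notMem_of_finite (ω : N [⋀^ι]→ₗ[R] R) {T : Set (Ideal R)} (hfin : T.Finite)
    (hT : ∀ p ∈ T, p.IsPrime) (h : ∀ p ∈ T, ∃ u, ω u ∉ p) : ∃ u, ∀ p ∈ T, ω u ∉ p := by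
  classical
  have hfin' : {p | Maximal (· ∈ T) p}.Finite := hfin.subset fun p hp => hp.prop
  obtain ⟨u, hu⟩ := exists_notMem_of_antichain ω hfin'.toFinset
    (fun p hp => hT p (hfin'.mem_toFinset.1 hp).prop)
    (fun p hp q hq hpq => le_antisymm hpq
      ((hfin'.mem_toFinset.1 hp).2 (hfin'.mem_toFinset.1 hq).prop hpq))
    (fun p hp => h p (hfin'.mem_toFinset.1 hp).prop)
  refine ⟨u, fun p hp hmem => ?_⟩
  obtain ⟨q, hpq, hq⟩ := hfin.exists_le_maximal hp
  exact hu q (hfin'.mem_toFinset.2 hq) (hpq hmem)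

theorem exists_mem_nonZeroDivisors [IsNoetherianRing R] (ω : N [⋀^ι]→ₗ[R] R)
    (h : ∀ p ∈ associatedPrimes R R, ∃ u, ω u ∉ p) : ∃ u, ω u ∈ nonZeroDivisors R := by
  obtain ⟨u, hu⟩ := exists_notMem_of_finite ω (associatedPrimes.finite R R)
    (fun p hp => hp.isPrime) h
  refine ⟨u, ?_⟩
  by_contra hcon
  have : ω u ∈ ((nonZeroDivisors R : Set R))ᶜ := hcon
  rw [← biUnion_associatedPrimes_eq_compl_nonZeroDivisors] at this
  obtain ⟨p, hp, hmem⟩ := Set.mem_iUnion₂.1 this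
  exact hu p hp hmem

end Avoidance

section Localization

variable {R : Type*} [CommRing R] {N : Type*} [AddCommGroup N] [Module R N]
  (S : Submonoid R) (A : Type*) [CommRing A] [Algebra R A] [IsLocalization S A]
  {N' : Type*} [AddCommGroup N'] [Module R N'] [Module A N'] [IsScalarTower R A N']
  (f : N →ₗ[R] N') [IsLocalizedModule S f]

/-- The coordinate functionals divided by the unit `ω v` are dual to `v`, giving independence;
Cramer's rule gives generation. -/
theorem IsCramer.exists_basis {ι : Type*} [Fintype ι] [DecidableEq ι] {ω : N [⋀^ι]→ₗ[R] R}
    (hω : IsCramer ω) {v : ι → N} (hv : ω v ∈ S) : ∃ b : Basis ι A N', ∀ i, b i = f (v i) := by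
  have hunit : IsUnit (algebraMap R A (ω v)) := IsLocalization.map_units A (⟨_, hv⟩ : S)
  let l : ι → N' →ₗ[A] A := fun i =>
    IsLocalizedModule.mapExtendScalars S f (Algebra.linearMap R A) A (coordForm ω v i)
  have hl : ∀ i y, l i (f y) = algebraMap R A (ω (Function.update v i y)) := fun i y => by
    simp only [l, IsLocalizedModule.mapExtendScalars_apply_apply, IsLocalizedModule.map_apply]
    rfl
  have hlv : ∀ i j, l i (f (v j)) = if i = j then algebraMap R A (ω v) else 0 := fun i j => by
    rw [hl, ← coordForm_apply, coordForm_family]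
    split_ifs <;> simp
  have hli : LinearIndependent A fun i => f (v i) := by
    rw [Fintype.linearIndependent_iff]
    intro c hc j
    have := congrArg (l j) hc
    rw [map_sum, map_zero] at this
    simp only [map_smul, hlv, smul_eq_mul, mul_ite, mul_zero, Finset.sum_ite_eq, Finset.mem_univ,
      if_true] at this
    exact (hunit.mul_left_eq_zero).1 this
  have hspan : ⊤ ≤ Submodule.span A (Set.range fun i => f (v i)) := by
    intro y' _
    obtain ⟨⟨y, s⟩, h⟩ := IsLocalizedModule.surj S f y'
    have h1 : (⟨ω v, hv⟩ * s : S) • y' = ∑ i, ω (Function.update v i y) • f (v i) := by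
      rw [mul_smul, h]
      change ω v • f y = _
      rw [← map_smul, hω v y, map_sum]
      simp only [map_smul]
    rw [← IsLocalization.smul_mem_iff (s := (⟨ω v, hv⟩ * s : S)), h1]
    refine Submodule.sum_mem _ fun i _ => ?_
    rw [← algebraMap_smul A]
    exact Submodule.smul_mem _ _ (Submodule.subset_span ⟨i, rfl⟩)
  exact ⟨Basis.mk hli hspan, fun i => Basis.mk_apply hli hspan i⟩

end Localization

theorem exists_basis_eq_map {R : Type*} [CommRing R] {N : Type*} [AddCommGroup N] [Module R N]
    (S : Submonoid R) (A : Type*) [CommRing A] [Algebra R A] [IsLocalization S A]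
    {N' : Type*} [AddCommGroup N'] [Module R N'] [Module A N'] [IsScalarTower R A N']
    (f : N →ₗ[R] N') [IsLocalizedModule S f] {ι : Type*} (b : Basis ι A N') :
    ∃ (b' : Basis ι A N') (u : ι → N), ∀ i, b' i = f (u i) := by
  choose x hx using fun i => IsLocalizedModule.surj S f (b i)
  let w : ι → Aˣ := fun i => (IsLocalization.map_units A (x i).2).unit
  have hw : ∀ i, b.unitsSMul w i = w i • b i := fun i => b.unitsSMul_apply i
  refine ⟨b.unitsSMul w, fun i => (x i).1, fun i => ?_⟩
  rw [hw, ← hx, Units.smul_def, IsUnit.unit_spec, algebraMap_smul]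
  rfl

/-- The rank over the total ring of fractions is the rank of every free localization. -/
theorem card_eq_of_hasRank {R : Type*} [CommRing R] {N : Type*} [AddCommGroup N] [Module R N]
    (S : Submonoid R) (A : Type*) [CommRing A] [Algebra R A] [IsLocalization S A]
    {N' : Type*} [AddCommGroup N'] [Module R N'] [Module A N'] [IsScalarTower R A N']
    (f : N →ₗ[R] N') [IsLocalizedModule S f] [Nontrivial A] {k k' : ℕ} (hk : HasRank R N k)
    (b : Basis (Fin k') A N') : k' = k := by
  obtain ⟨b₀⟩ := hk
  let Q := Localization (nonZeroDivisors R)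
  let g := LocalizedModule.mkLinearMap (nonZeroDivisors R) N
  obtain ⟨c, u, hu⟩ := exists_basis_eq_map (nonZeroDivisors R) Q g b₀
  obtain ⟨d, v, hv⟩ := exists_basis_eq_map S A f b
  have hcu : (c : Fin k → _) = g ∘ u := funext hu
  have hinj : Function.Injective (algebraMap R Q) := IsLocalization.injective Q le_rfl
  have hliu : LinearIndependent R u := by
    have h1 : LinearIndependent R (g ∘ u) := by
      rw [← hcu]
      refine c.linearIndependent.restrict_scalars ?_
      simpa [Algebra.smul_def] using hinj
    exact h1.of_comp g
  have hle : k ≤ k' := by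
    have : Module.Finite A N' := Module.Finite.of_basis b
    have h2 := (hliu.of_isLocalizedModule A S f).fintype_card_le_finrank
    rwa [finrank_eq_card_basis b, Fintype.card_fin, Fintype.card_fin] at h2
  have htop : (Submodule.span R (Set.range u)).localized' Q (nonZeroDivisors R) g = ⊤ := by
    rw [Submodule.localized'_span, ← Set.range_comp, ← hcu, c.span_eq]
  -- The elements of `S` may be zero divisors and `t` need not become a unit in `A`. But `t` stays a
  -- nonzerodivisor there, so the scaled family remains independent and lies in the span of `k`
  -- vectors.
  have ht : ∀ y : N, ∃ t ∈ nonZeroDivisors R, t • y ∈ Submodule.span R (Set.range u) := by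
    intro y
    have hy : g y ∈ (Submodule.span R (Set.range u)).localized' Q (nonZeroDivisors R) g := by
      rw [htop]; trivial
    obtain ⟨z, hz, s, hs⟩ := (Submodule.mem_localized' _ _ _ _ _).1 hy
    rw [IsLocalizedModule.mk'_eq_iff] at hs
    have hs' : g z = g ((s : R) • y) := by rw [hs, map_smul]; rfl
    obtain ⟨t, ht⟩ := IsLocalizedModule.exists_of_eq (S := nonZeroDivisors R) hs'
    refine ⟨t * s, mul_mem t.2 s.2, ?_⟩
    rw [mul_smul]
    change t • ((s : R) • y) ∈ _
    rw [← ht]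
    exact Submodule.smul_mem _ (t : R) hz
  choose t ht0 ht using fun j => ht (v j)
  have htA : ∀ j, algebraMap R A (t j) ∈ nonZeroDivisors A := fun j =>
    IsLocalization.map_nonZeroDivisors_le S A ⟨t j, ht0 j, rfl⟩
  have hli : LinearIndependent A fun j => f (t j • v j) := by
    rw [Fintype.linearIndependent_iff]
    intro e he j
    have h1 : ∑ j, (e j * algebraMap R A (t j)) • d j = 0 := by
      rw [← he]
      refine Finset.sum_congr rfl fun i _ => ?_
      rw [mul_smul, map_smul, algebraMap_smul, hv]
    have h2 := Fintype.linearIndependent_iff.1 d.linearIndependent _ h1 j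
    exact (mul_right_mem_nonZeroDivisors_eq_zero_iff (htA j)).1 h2
  have hge : k' ≤ k := by
    have hsub : Set.range (fun j => f (t j • v j)) ⊆ Submodule.span A (Set.range (f ∘ u)) := by
      rintro _ ⟨j, rfl⟩
      have h1 : f (t j • v j) ∈ (Submodule.span R (Set.range u)).map f := ⟨_, ht j, rfl⟩
      rw [Submodule.map_span, ← Set.range_comp] at h1
      exact Submodule.span_le_restrictScalars R A _ h1
    classical
    have h3 := linearIndependent_le_span' _ hli (Set.range (f ∘ u)) hsub
    rw [Cardinal.mk_fin] at h3
    have h4 : Fintype.card (Set.range (f ∘ u)) ≤ k := by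
      simpa using Fintype.card_range_le (f ∘ u)
    exact (Nat.cast_le.1 h3).trans h4
  exact le_antisymm hge hle

section Complement

variable {R : Type*} [CommRing R] {N : Type*} [AddCommGroup N] [Module R N]

theorem IsCramer.hasRank {k : ℕ} {ω : N [⋀^Fin k]→ₗ[R] R} (hω : IsCramer ω) {u : Fin k → N}
    (hu : ω u ∈ nonZeroDivisors R) : HasRank R N k := by
  obtain ⟨b, -⟩ := hω.exists_basis (nonZeroDivisors R) (Localization (nonZeroDivisors R))
    (LocalizedModule.mkLinearMap (nonZeroDivisors R) N) hu
  exact ⟨b⟩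

/-- The kernel of a functional splits off at a prime not containing the image. -/
theorem exists_isCompl_localized_ker (χ : N →ₗ[R] R) (p : Ideal R) [p.IsPrime] {x : N}
    (hx : χ x ∉ p) : ∃ W : Submodule (Localization p.primeCompl) (LocalizedModule p.primeCompl N),
      IsCompl ((LinearMap.ker χ).localized p.primeCompl) W := by
  let S := p.primeCompl
  let A := Localization S
  let U := LinearMap.ker χ
  let g := LocalizedModule.mkLinearMap S N
  let π : N →ₗ[R] U := LinearMap.codRestrict U (χ x • LinearMap.id - χ.smulRight x) fun y => by
    rw [LinearMap.mem_ker]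
    simp [mul_comm]
  have hπ : ∀ u : U, π u = χ x • u := fun u => by
    apply Subtype.ext
    have hu : χ u = 0 := u.2
    simp [π, hu]
  let π' : LocalizedModule S N →ₗ[A] U.localized S :=
    IsLocalizedModule.mapExtendScalars S g (U.toLocalized S) A π
  have hπ' : ∀ y, π' (g y) = U.toLocalized S (π y) := fun y => by
    simp only [π', IsLocalizedModule.mapExtendScalars_apply_apply, IsLocalizedModule.map_apply]
  let t : Aˣ := (IsLocalization.map_units A (⟨χ x, hx⟩ : S)).unit
  have hz : ∀ z : U.localized S, π' z = t • z := by
    intro z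
    obtain ⟨⟨u, s⟩, h⟩ := IsLocalizedModule.surj S (U.toLocalized S) z
    have h1 : g u = s • (z : LocalizedModule S N) := (congrArg Subtype.val h).symm
    refine IsLocalizedModule.smul_injective (U.toLocalized S) s ?_
    change s • π' z = s • (t • z)
    have h2 : s • π' (z : LocalizedModule S N) = π' (s • (z : LocalizedModule S N)) := by
      rw [Submonoid.smul_def, ← algebraMap_smul A, ← map_smul, algebraMap_smul]
      rfl
    rw [h2, ← h1, hπ', hπ, map_smul, ← h, smul_comm, Units.smul_def, IsUnit.unit_spec,
      algebraMap_smul]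
  refine ⟨_, LinearMap.isCompl_of_proj (f := (↑(t⁻¹) : A) • π') fun z => ?_⟩
  rw [LinearMap.smul_apply, hz, ← Units.smul_def, inv_smul_smul]

end Complement

end KoszulProjDimOne

/-! ### Local summands, orientations and the two implications -/

namespace KoszulProjDimOne

open Module

section Summand

variable {R : Type*} [CommRing R] {N : Type*} [AddCommGroup N] [Module R N]

/-- Over a localization in which `ω` takes a unit value, `ω` is a unit multiple of the determinant
with respect to the resulting basis. -/
theorem IsCramer.algebraMap_eq_mul_det {ι : Type*} [Fintype ι] [DecidableEq ι]
    {ω : N [⋀^ι]→ₗ[R] R} (hω : IsCramer ω) (A : Type*) [CommRing A] [Algebra R A]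
    {N' : Type*} [AddCommGroup N'] [Module R N'] [Module A N'] [IsScalarTower R A N']
    (f : N →ₗ[R] N') {v : ι → N} (hv : IsUnit (algebraMap R A (ω v))) (b : Basis ι A N')
    (hb : ∀ i, b i = f (v i)) (y : ι → N) :
    algebraMap R A (ω y) = algebraMap R A (ω v) * b.det (f ∘ y) := by
  let B : N [⋀^ι]→ₗ[R] A :=
    { (b.det.toMultilinearMap.restrictScalars R).compLinearMap (fun _ => f) with
      map_eq_zero_of_eq' := fun v i j hij hne =>
        b.det.map_eq_zero_of_eq (f ∘ v) (congrArg f hij) hne }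
  have hB : ∀ y, B y = b.det (f ∘ y) := fun y => rfl
  have hBv : B v = 1 := by
    rw [hB, show f ∘ v = b from (funext hb).symm, b.det_self]
  -- The same coordinate determinant relates both `B` and `ω` at `y` to their values at `v`.
  have h1 := hω.pow_smul B v y
  have h2 := congrArg (algebraMap R A) (hω.pow_smul ω v y)
  rw [hBv, hB, Algebra.smul_def, Algebra.smul_def, mul_one, map_pow] at h1
  rw [smul_eq_mul, smul_eq_mul, map_mul, map_mul, map_pow, ← h1] at h2
  refine (hv.pow (Fintype.card ι)).mul_left_cancel ?_
  rw [h2]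
  ring

/-- At `p` the module is free of rank `k + 1`, so the complement of `U` is projective of rank one
over a local ring, hence free. Its generator and a basis of the localized `U`, with denominators
cleared, form a basis of the whole, on which `ω` is a unit times an invertible determinant. -/
theorem IsCramer.exists_vecCons_notMem {k : ℕ} {ω : N [⋀^Fin (k + 1)]→ₗ[R] R} (hω : IsCramer ω)
    {p : Ideal R} [p.IsPrime] {v : Fin (k + 1) → N} (hv : ω v ∉ p) {U : Submodule R N}
    (hU : IsFreeDirectSummandAt U p) (hk : HasRank R U k) :
    ∃ x, ∃ u : Fin k → U, ω (Matrix.vecCons x fun i => (u i : N)) ∉ p := by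
  obtain ⟨hfree, W, hW⟩ := hU
  let S := p.primeCompl
  let A := Localization S
  let g := LocalizedModule.mkLinearMap S N
  let Up := U.localized S
  have hunit : IsUnit (algebraMap R A (ω v)) := IsLocalization.map_units A (⟨_, hv⟩ : S)
  obtain ⟨X, hX⟩ := hω.exists_basis S A g (v := v) hv
  have hfinN : Module.Finite A (LocalizedModule S N) := Module.Finite.of_basis X
  let E := Submodule.prodEquivOfIsCompl Up W hW
  have hfinP : Module.Finite A (Up × W) := Module.Finite.equiv E.symm
  have hfinU : Module.Finite A Up :=
    Module.Finite.of_surjective (LinearMap.fst A Up W) LinearMap.fst_surjective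
  have hfinW : Module.Finite A W :=
    Module.Finite.of_surjective (LinearMap.snd A Up W) LinearMap.snd_surjective
  have hfreeN : Module.Free A (LocalizedModule S N) := Module.Free.of_basis X
  have hprojP : Module.Projective A (Up × W) := Module.Projective.of_equiv E.symm
  have hprojW : Module.Projective A W :=
    Module.Projective.of_split (LinearMap.inr A Up W) (LinearMap.snd A Up W) (by ext; simp)
  have hfreeW : Module.Free A W := Module.free_of_flat_of_isLocalRing
  have hrkU : finrank A Up = k :=
    card_eq_of_hasRank S A (U.toLocalized S) hk (finBasis A Up)
  have hrkW : finrank A W = 1 := by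
    have h1 : finrank A (Up × W) = k + 1 := by
      rw [E.finrank_eq, finrank_eq_card_basis X, Fintype.card_fin]
    rw [finrank_prod, hrkU] at h1
    omega
  obtain ⟨b, u, hbu⟩ := exists_basis_eq_map S A (U.toLocalized S) (finBasisOfFinrankEq A Up hrkU)
  let w := finBasisOfFinrankEq A W hrkW
  obtain ⟨⟨x, s⟩, hx⟩ := IsLocalizedModule.surj S g (w 0 : LocalizedModule S N)
  let t : Aˣ := (IsLocalization.map_units A s).unit
  have hxt : g x = (t : A) • (w 0 : LocalizedModule S N) := by
    rw [← hx, IsUnit.unit_spec, algebraMap_smul]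
    rfl
  let Y := Basis.mkFinCons (g x) b (fun c z hz h => by
      have hmem : c • g x ∈ Up ⊓ W := by
        refine ⟨?_, ?_⟩
        · rw [eq_neg_of_add_eq_zero_left h]
          exact Up.neg_mem hz
        · rw [hxt]
          exact W.smul_mem _ (W.smul_mem _ (w 0).2)
      rw [hW.inf_eq_bot, Submodule.mem_bot, hxt, smul_smul] at hmem
      have h1 : (c * (t : A)) • w 0 = 0 := Subtype.ext hmem
      have h2 := Fintype.linearIndependent_iff.1 w.linearIndependent (fun _ => c * (t : A))
        (by rw [Fin.sum_univ_one, h1]) 0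
      exact (t.isUnit.mul_left_eq_zero).1 h2)
    (fun z => by
      obtain ⟨⟨z₁, z₂⟩, rfl⟩ := E.surjective z
      refine ⟨-(w.repr z₂ 0 * ((t⁻¹ : Aˣ) : A)), ?_⟩
      have h1 : w.repr z₂ 0 • w 0 = z₂ := by
        conv_rhs => rw [← w.sum_repr z₂]
        rw [Fin.sum_univ_one]
      have h2 : w.repr z₂ 0 • (w 0 : LocalizedModule S N) = z₂ := congrArg Subtype.val h1
      rw [hxt, smul_smul, neg_mul, mul_assoc, Units.inv_mul, mul_one, neg_smul, h2]
      have : E (z₁, z₂) = z₁ + z₂ := by simp [E]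
      rw [this, add_neg_cancel_right]
      exact z₁.2)
  have hY : (Y : Fin (k + 1) → _) = g ∘ Matrix.vecCons x fun i => (u i : N) := by
    rw [Basis.coe_mkFinCons]
    ext i
    refine Fin.cases rfl (fun j => ?_) i
    rw [Fin.cons_succ]
    exact congrArg Subtype.val (hbu j)
  have hdet := X.isUnit_det Y
  have key := hω.algebraMap_eq_mul_det A g hunit X hX (Matrix.vecCons x fun i => (u i : N))
  rw [← hY] at key
  refine ⟨x, u, ?_⟩
  have h3 : IsUnit (algebraMap R A (ω (Matrix.vecCons x fun i => (u i : N)))) := by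
    rw [key]
    exact hunit.mul hdet
  exact (IsLocalization.AtPrime.isUnit_to_map_iff A p _).1 h3

end Summand

section Orientation

variable {R : Type*} [CommRing R] {N : Type*} [AddCommGroup N] [Module R N]

/-- Functionals on the exterior power are the alternating forms, and these are free on `ω`. -/
theorem IsCramer.nonempty_dual_exteriorPower {k : ℕ} {ω : N [⋀^Fin k]→ₗ[R] R} (hω : IsCramer ω)
    (h2 : 2 ≤ idealGrade (valueIdeal ω)) : Nonempty (Dual R (⋀[R]^k N) ≃ₗ[R] R) := by
  obtain ⟨a, ha, _, _, hreg⟩ := exists_isRegularPair h2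
  let L : R →ₗ[R] N [⋀^Fin k]→ₗ[R] R := LinearMap.toSpanSingleton R _ ω
  have hL : Function.Bijective L := by
    refine ⟨(injective_iff_map_eq_zero _).2 fun c hc => ?_, fun b => ?_⟩
    · refine eq_zero_of_forall_smul_eq_zero ha hreg.left c fun v => ?_
      have := DFunLike.congr_fun hc v
      simpa [L, mul_comm] using this
    · obtain ⟨c, hc⟩ := hω.exists_eq_smul h2 b
      exact ⟨c, hc.symm⟩
  exact ⟨(exteriorPower.alternatingMapLinearEquiv.symm).trans (LinearEquiv.ofBijective L hL).symm⟩

theorem nonempty_bidual_of_dual (e : Dual R N ≃ₗ[R] R) :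
    Nonempty (Dual R (Dual R N) ≃ₗ[R] R) :=
  ⟨e.symm.dualMap.trans (LinearMap.ringLmapEquivSelf R R R)⟩

/-- A module whose double dual is free of rank one has a dual that is free of rank one. -/
theorem nonempty_dual_of_bidual (e : Dual R (Dual R N) ≃ₗ[R] R) :
    Nonempty (Dual R N ≃ₗ[R] R) := by
  let ζ : Dual R N →ₗ[R] R := e.symm 1
  let φ₀ : Dual R N := e.toLinearMap ∘ₗ Dual.eval R N
  have h : ∀ φ, φ = ζ φ • φ₀ := fun φ => by
    ext n
    have h1 : Dual.eval R N n = e (Dual.eval R N n) • e.symm 1 := by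
      rw [← map_smul, smul_eq_mul, mul_one, e.symm_apply_apply]
    have h2 := LinearMap.congr_fun h1 φ
    rw [Dual.eval_apply] at h2
    rw [h2, LinearMap.smul_apply, LinearMap.smul_apply, smul_eq_mul, smul_eq_mul, mul_comm]
    rfl
  have hφ₀ : (1 - ζ φ₀) • φ₀ = 0 := by
    ext n
    have hn := LinearMap.congr_fun (h φ₀) n
    rw [LinearMap.smul_apply, smul_eq_mul] at hn ⊢
    rw [sub_mul, one_mul, ← hn, sub_self, LinearMap.zero_apply]
  have hζ : (1 - ζ φ₀) • ζ = 0 := by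
    ext φ
    rw [LinearMap.smul_apply, ← map_smul, h φ, smul_comm, hφ₀, smul_zero, map_zero,
      LinearMap.zero_apply]
  -- `ζ` generates the free module `N**`, so the scalar killing it is zero.
  have hone : ζ φ₀ = 1 := by
    have h1 : (1 - ζ φ₀) • e.symm 1 = 0 := hζ
    rw [← map_smul, smul_eq_mul, mul_one, LinearEquiv.map_eq_zero_iff, sub_eq_zero] at h1
    exact h1.symm
  refine ⟨LinearEquiv.ofBijective ζ ⟨(injective_iff_map_eq_zero _).2 fun φ hφ => ?_, fun c => ?_⟩⟩
  · rw [h φ, hφ, zero_smul]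
  · exact ⟨c • φ₀, by rw [map_smul, hone, smul_eq_mul, mul_one]⟩

/-- If the dual of the `k`-th exterior power of `U` is free of rank one, then contraction of a
form of degree `k + 1` with `U` is given by a functional. -/
theorem exists_functional_of_dual {k : ℕ} (ω : N [⋀^Fin (k + 1)]→ₗ[R] R) (U : Submodule R N)
    (e : Dual R (⋀[R]^k U) ≃ₗ[R] R) : ∃ (χ : N →ₗ[R] R) (a : U [⋀^Fin k]→ₗ[R] R), ∀ x u,
      ω (Matrix.vecCons x fun i => (u i : N)) = χ x * a u := by
  let E : U [⋀^Fin k]→ₗ[R] R ≃ₗ[R] R := exteriorPower.alternatingMapLinearEquiv.trans e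
  -- Contraction takes values in a free module of rank one; `χ x` is the coordinate of `c x`.
  let c : N →ₗ[R] U [⋀^Fin k]→ₗ[R] R :=
    { toFun := fun x => (ω.curryLeft x).compLinearMap U.subtype
      map_add' := fun x y => by ext u; simp
      map_smul' := fun t x => by ext u; simp }
  refine ⟨E.toLinearMap ∘ₗ c, E.symm 1, fun x u => ?_⟩
  have h : c x = E (c x) • E.symm 1 := by
    rw [← map_smul, smul_eq_mul, mul_one, E.symm_apply_apply]
  exact DFunLike.congr_fun h u

end Orientation

section Main

variable {R : Type*} [CommRing R]

theorem exists_notMem_of_not_le {X : Type*} {f : X → R} {p : Ideal R}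
    (h : ¬ Ideal.span (Set.range f) ≤ p) : ∃ x, f x ∉ p := by
  by_contra! hcon
  exact h (Ideal.span_le.2 (Set.range_subset_iff.2 hcon))

theorem exists_notMem_range {M : Type*} [AddCommGroup M] [Module R M] {χ : M →ₗ[R] R} {p : Ideal R}
    (h : ¬ LinearMap.range χ ≤ p) : ∃ x, χ x ∉ p := by
  by_contra! hcon
  apply h
  rintro _ ⟨x, rfl⟩
  exact hcon x

/-- The zero ring has no primes, so every ideal there has grade `⊤`. -/
theorem nontrivial_of_idealGrade_eq [IsNoetherianRing R] {I : Ideal R} {k : ℕ}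
    (h : idealGrade I = k) : Nontrivial R := by
  by_contra hcon
  rw [not_nontrivial_iff_subsingleton] at hcon
  have h1 := natCast_le_idealGrade_of_forall_prime (I := I) (k := k + 1)
    fun p hp _ => absurd (Subsingleton.elim p ⊤) hp.ne_top
  rw [h] at h1
  have : k + 1 ≤ k := by exact_mod_cast h1
  omega

theorem hasRank_unique [Nontrivial R] {N : Type*} [AddCommGroup N] [Module R N] {k k' : ℕ}
    (h : HasRank R N k) (h' : HasRank R N k') : k' = k := by
  have : Nontrivial (Localization (nonZeroDivisors R)) :=
    (IsLocalization.injective _ (le_refl (nonZeroDivisors R))).nontrivial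
  obtain ⟨b⟩ := h'
  exact card_eq_of_hasRank (nonZeroDivisors R) (Localization (nonZeroDivisors R))
    (LocalizedModule.mkLinearMap (nonZeroDivisors R) N) h b

/-- The kernel of a functional with large image is reflexive, orientable and a local direct
summand. -/
theorem IsCramer.ker_properties [IsNoetherianRing R] {M : Type*} [AddCommGroup M] [Module R M]
    {k : ℕ} {ω : M [⋀^Fin (k + 1)]→ₗ[R] R} (hω : IsCramer ω) {a b : R} (ha : a ∈ valueIdeal ω)
    (hb : b ∈ valueIdeal ω) (hab : IsRegularPair M a b) (ha' : ∀ x, a * x = 0 → x = 0)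
    (hg : ((k + 2 : ℕ) : ℕ∞) ≤ idealGrade (valueIdeal ω)) (χ : M →ₗ[R] R)
    (hχ : ((k + 2 : ℕ) : ℕ∞) ≤ idealGrade (LinearMap.range χ)) :
    HasRank R (LinearMap.ker χ) k ∧ IsReflexive R (LinearMap.ker χ) ∧
      IsOrientable R (LinearMap.ker χ) ∧ ∀ (p : Ideal R) [p.IsPrime],
        idealGrade p ≤ ((k + 1 : ℕ) : ℕ∞) → IsFreeDirectSummandAt (LinearMap.ker χ) p := by
  have hsmall : ∀ {I : Ideal R}, ((k + 2 : ℕ) : ℕ∞) ≤ idealGrade I → 2 ≤ idealGrade I := fun h =>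
    le_trans (by exact_mod_cast Nat.le_add_left 2 k) h
  obtain ⟨_, ⟨x₀, rfl⟩, _, _, hx₀⟩ := exists_isRegularPair (hsmall hχ)
  obtain ⟨α, hα⟩ := hω.exists_form_ker χ (hsmall hχ)
  have hCα : IsCramer α := hω.form_ker_isCramer hα (x₀ := x₀) fun y hy =>
    hω.eq_zero_of_smul_eq_zero ha hab.left hx₀.left hy
  have hrefl : IsReflexive R M := hω.isReflexive ha hb hab ha ha'
  have hnot : ∀ (p : Ideal R) [p.IsPrime], ¬ LinearMap.range χ ≤ p → ¬ valueIdeal ω ≤ p →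
      ∃ u, α u ∉ p := by
    intro p _ h1 h2
    obtain ⟨x, hx⟩ := exists_notMem_range h1
    obtain ⟨v, hv⟩ := exists_notMem_of_not_le h2
    exact hω.exists_form_ker_notMem hα hx hv
  -- A prime containing all values of `α` contains `Im χ` or all values of `ω`, both of grade at
  -- least two.
  have hα2 : 2 ≤ idealGrade (valueIdeal α) := by
    refine natCast_le_idealGrade_of_forall_prime (k := 2) fun p _ hp => ?_
    by_contra hcon
    obtain ⟨u, hu⟩ := hnot p (fun h => hcon ((hsmall hχ).trans (idealGrade_mono h)))
      fun h => hcon ((hsmall hg).trans (idealGrade_mono h))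
    exact hu (hp (Ideal.subset_span ⟨u, rfl⟩))
  obtain ⟨c, hc, _, _, hcreg⟩ := exists_isRegularPair hα2
  obtain ⟨u, hu⟩ := exists_mem_nonZeroDivisors α fun p hp => exists_notMem_of_not_le fun h => by
    have h1 : c ∈ ⋃ p ∈ associatedPrimes R R, (p : Set R) := Set.mem_biUnion hp (h hc)
    rw [biUnion_associatedPrimes_eq_compl_nonZeroDivisors] at h1
    exact h1 (mem_nonZeroDivisors_iff_right.2 fun x hx => hcreg.left x (by
      rwa [smul_eq_mul, mul_comm]))
  have hrank := hCα.hasRank hu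
  obtain ⟨e⟩ := hCα.nonempty_dual_exteriorPower hα2
  refine ⟨hrank, isReflexive_ker χ hx₀.left, ⟨k, hrank, nonempty_bidual_of_dual e⟩, ?_⟩
  intro p _ hp
  have hle : ∀ I : Ideal R, ((k + 2 : ℕ) : ℕ∞) ≤ idealGrade I → ¬ I ≤ p := fun I hI h => by
    have h1 : k + 2 ≤ k + 1 := by exact_mod_cast (hI.trans (idealGrade_mono h)).trans hp
    omega
  obtain ⟨x, hx⟩ := exists_notMem_range (hle _ hχ)
  obtain ⟨u, hu⟩ := hnot p (hle _ hχ) (hle _ hg)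
  obtain ⟨B, -⟩ := hCα.exists_basis p.primeCompl (Localization p.primeCompl)
    ((LinearMap.ker χ).toLocalized p.primeCompl) hu
  exact ⟨Module.Free.of_basis B, exists_isCompl_localized_ker χ p hx⟩

/-- An orientable local direct summand of corank one yields a functional with large image. -/
theorem IsCramer.exists_functional [IsNoetherianRing R] [Nontrivial R] {M : Type*} [AddCommGroup M]
    [Module R M] {k : ℕ} {ω : M [⋀^Fin (k + 1)]→ₗ[R] R} (hω : IsCramer ω)
    (hg : ((k + 2 : ℕ) : ℕ∞) ≤ idealGrade (valueIdeal ω)) {U : Submodule R M}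
    (hrank : HasRank R U k) (hor : IsOrientable R U)
    (hU : ∀ (p : Ideal R) [p.IsPrime], idealGrade p ≤ ((k + 1 : ℕ) : ℕ∞) →
      IsFreeDirectSummandAt U p) :
    ∃ χ : M →ₗ[R] R, ((k + 2 : ℕ) : ℕ∞) ≤ idealGrade (LinearMap.range χ) := by
  obtain ⟨k', hrank', ⟨e⟩⟩ := hor
  obtain rfl := hasRank_unique hrank hrank'
  obtain ⟨e'⟩ := nonempty_dual_of_bidual e
  obtain ⟨χ, α, h⟩ := exists_functional_of_dual ω U e'
  refine ⟨χ, natCast_le_idealGrade_of_forall_prime fun p _ hp => ?_⟩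
  by_contra hcon
  have hle : idealGrade p ≤ ((k' + 1 : ℕ) : ℕ∞) := by
    have h1 : idealGrade p < ((k' + 1 : ℕ) : ℕ∞) + 1 := by
      have := not_le.1 hcon
      exact_mod_cast this
    exact Order.le_of_lt_add_one h1
  -- At a prime over `Im χ` of too small grade, `U` would be a summand and some `ω(x, u) = χ x * α
  -- u` would lie outside the prime.
  obtain ⟨v, hv⟩ := exists_notMem_of_not_le (p := p) (f := ω) fun h =>
    hcon (hg.trans (idealGrade_mono h))
  obtain ⟨x, u, hxu⟩ := hω.exists_vecCons_notMem hv (hU p hle) hrank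
  rw [h] at hxu
  exact hxu (p.mul_mem_right _ (hp ⟨x, rfl⟩))

/-- The coordinate presentation of `CokerDual ψ` by the transpose of the matrix of `ψ`. -/
theorem exists_presentation {G F : Type*} [AddCommGroup G] [Module R G] [AddCommGroup F]
    [Module R F] {m n : ℕ} (bG : Basis (Fin n) R G) (bF : Basis (Fin m) R F) (ψ : G →ₗ[R] F) :
    ∃ π : (Fin n → R) →ₗ[R] CokerDual ψ, Function.Surjective π ∧
      ∀ x, π x = 0 ↔ ∃ g, Matrix.vecMul g (LinearMap.toMatrix bG bF ψ) = x := by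
  let eG := bG.dualBasis.equivFun
  let eF := bF.dualBasis.equivFun
  have heG : ∀ φ j, eG φ j = φ (bG j) := fun φ j => by simp [eG]
  have heF : ∀ φ j, eF φ j = φ (bF j) := fun φ j => by simp [eF]
  have key : ∀ φ, eG (ψ.dualMap φ) = Matrix.vecMul (eF φ) (LinearMap.toMatrix bG bF ψ) := by
    intro φ
    ext j
    rw [heG, LinearMap.dualMap_apply, ← bF.sum_repr (ψ (bG j)), map_sum, Matrix.vecMul, dotProduct]
    refine Finset.sum_congr rfl fun i _ => ?_
    rw [map_smul, smul_eq_mul, mul_comm, heF, LinearMap.toMatrix_apply]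
  refine ⟨(LinearMap.range ψ.dualMap).mkQ ∘ₗ eG.symm.toLinearMap,
    (Submodule.mkQ_surjective _).comp eG.symm.surjective, fun x => ?_⟩
  rw [LinearMap.comp_apply, Submodule.mkQ_apply, Submodule.Quotient.mk_eq_zero]
  constructor
  · rintro ⟨φ, hφ⟩
    exact ⟨eF φ, by rw [← key, hφ]; exact eG.apply_symm_apply x⟩
  · rintro ⟨g, rfl⟩
    refine ⟨eF.symm g, eG.injective ?_⟩
    rw [key, eF.apply_symm_apply]
    exact (eG.apply_symm_apply _).symm

end Main

end KoszulProjDimOne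

theorem proposition7 {R G F : Type*} [CommRing R] [IsNoetherianRing R]
    [AddCommGroup G] [Module R G] [AddCommGroup F] [Module R F]
    {m n r : ℕ} (bG : Module.Basis (Fin n) R G) (bF : Module.Basis (Fin m) R F)
    (ψ : G →ₗ[R] F) (hn : n = m + r) (hr : 1 < r)
    (hg : KoszulProjDimOne.idealGrade (KoszulProjDimOne.maximalMinors bG bF ψ) = (r : ℕ∞) + 1) :
    (∃ χ : KoszulProjDimOne.CokerDual ψ →ₗ[R] R,
        KoszulProjDimOne.idealGrade (LinearMap.range χ) = (r : ℕ∞) + 1) ↔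
      ∃ U : Submodule R (KoszulProjDimOne.CokerDual ψ),
        KoszulProjDimOne.HasRank R U (r - 1) ∧
        Module.IsReflexive R U ∧
        KoszulProjDimOne.IsOrientable R U ∧
        ∀ (p : Ideal R) [p.IsPrime], KoszulProjDimOne.idealGrade p ≤ (r : ℕ∞) →
          KoszulProjDimOne.IsFreeDirectSummandAt U p := by
  open KoszulProjDimOne in
  subst hn
  obtain ⟨k, rfl⟩ : ∃ k, r = k + 1 := ⟨r - 1, by omega⟩
  rw [Nat.add_sub_cancel]
  have hcast : (((k + 1 : ℕ) : ℕ∞) + 1) = ((k + 2 : ℕ) : ℕ∞) := by push_cast; ring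
  have hg' : idealGrade (minorsIdeal (LinearMap.toMatrix bG bF ψ)) = ((k + 1 : ℕ) : ℕ∞) + 1 := hg
  obtain ⟨π, hπ, hker⟩ := exists_presentation bG bF ψ
  obtain ⟨ω, hω, hle⟩ := exists_cramer_form (LinearMap.toMatrix bG bF ψ) π hπ hker
  have hgω : ((k + 2 : ℕ) : ℕ∞) ≤ idealGrade (valueIdeal ω) := by
    rw [← hcast, ← hg']
    exact idealGrade_mono hle
  constructor
  · rintro ⟨χ, hχ⟩
    -- Here `1 < r` enters: reflexivity of `M` needs a regular pair on `M`, hence three elements of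
    -- `R`.
    have h3 : 3 ≤ idealGrade (minorsIdeal (LinearMap.toMatrix bG bF ψ)) := by
      rw [hg', hcast]
      exact_mod_cast (by omega : 3 ≤ k + 2)
    obtain ⟨a, ha, b, hb, c, hc, h1, h2, h3⟩ := exists_regular_triple_of_three_le_idealGrade h3
    have hab := isRegularPair_cokernel _ π hπ hker hb hc h1 h2 h3
    exact ⟨LinearMap.ker χ, hω.ker_properties (hle ha) (hle hb) hab h1 hgω χ
      (by rw [hχ, hcast])⟩
  · rintro ⟨U, hrank, -, hor, hU⟩
    have : Nontrivial R := nontrivial_of_idealGrade_eq (hg'.trans hcast)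
    obtain ⟨χ, hχ⟩ := hω.exists_functional hgω hrank hor hU
    exact ⟨χ, le_antisymm (idealGrade_range_le _ π hπ hker (by omega) hg' χ) (by rwa [hcast])⟩
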